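/- **Downwards Löwenheim–Skolem Theorem for transition algebra.** Let $\Sigma$ be a countable signature and let $\Gamma$ be a set of $\Sigma$-sentences that is consistent, i.e. $\Gamma\not\vdash_\Sigma\bot$. Then there is a countable $\Sigma$-model $\mathfrak A$ with $\mathfrak A\models\Gamma$. Here "countable" means "at most countable", and the notions are as follows. *Signatures.* A signature $\Sigma=(S,F\supseteq M,L)$ has a set $S$ of sorts, sets $F_{w,s}$ of function symbols $\sigma\colon w\to s$ ($w\in S^*$, $s\in S$) with subsets $M_{w,s}\subseteq F_{w,s}$ of monotonic symbols, and a set $L$ of labels. It is countable if $S$, $L$ and the set of all declarations $\sigma\colon w\to s$ are countable. A morphism $\chi\colon\Sigma\to\Sigma'$ maps sorts to sorts, symbols $\sigma\colon s_1\cdots s_n\to s$ to symbols $\chi(\sigma)\colon\chi(s_1)\cdots\chi(s_n)\to\chi(s)$, monotonic ones to monotonic ones, and labels to labels. $\Sigma[X]$ is $\Sigma$ with the elements of a finite set $X$ of sorted variables (with distinct names $v_i$, $i<\omega$) added as new non-monotonic constants. *Models.* A $\Sigma$-model $\mathfrak A$ has possibly empty carriers $\mathfrak A_s$ ($s\in S$),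 functions $\sigma^{\mathfrak A}\colon\mathfrak A_{s_1}\times\dots\times\mathfrak A_{s_n}\to\mathfrak A_s$ and relations $\lambda^{\mathfrak A}_s\subseteq\mathfrak A_s\times\mathfrak A_s$ ($\lambda\in L$, $s\in S$), such that for $\sigma\in M$, $(a_k,b)\in\lambda^{\mathfrak A}_{s_k}$ implies $(\sigma^{\mathfrak A}(a_1,\dots,a_k,\dots,a_n),\sigma^{\mathfrak A}(a_1,\dots,b,\dots,a_n))\in\lambda^{\mathfrak A}_s$. It is countable if the disjoint union of its carriers is. *Sentences.* Actions: $\mathfrak a::=\lambda\mid\mathfrak a;\mathfrak a\mid\mathfrak a\cup\mathfrak a\mid\mathfrak a^*$, interpreted in a model, sort by sort, with composition, union and reflexive-transitive closure of relations. Sentences: $\phi::=t_1=t_2\mid t_1\stackrel{\mathfrak a}\Rightarrow t_2\mid\neg\phi\mid\bigvee\Phi\mid\exists X\cdot\phi'$, where $t_1,t_2$ are ground terms of the same sort, $\Phi$ is finite, and $\phi'$ is a $\Sigma[X]$-sentence; $\bot=\bigvee\emptyset$. Satisfaction is as expected; $\mathfrak A\models\exists X\cdot\phi'$ iff $\phi'$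 holds in some expansion of $\mathfrak A$ to $\Sigma[X]$. Morphisms $\chi$ translate sentences symbol by symbol, keeping the names of bound variables. *Entailment.* $\vdash$ is the least family of relations $\vdash_\Sigma$ between sets of $\Sigma$-sentences, over all signatures $\Sigma$, closed under the rules below; $\Gamma\vdash\phi$ means $\Gamma\vdash\{\phi\}$, and $\Sigma$-sentences are regarded as $\Sigma[X]$-sentences along the inclusion. - $\Gamma\vdash\Phi$ if $\Phi\subseteq\Gamma$; if $\Gamma\vdash\Phi$ and $\Phi\vdash\Psi$ then $\Gamma\vdash\Psi$; if $\Gamma\vdash\phi$ for all $\phi\in\Phi$ then $\Gamma\vdash\Phi$; if $\Gamma\vdash_\Sigma\Phi$ and $\chi\colon\Sigma\to\Sigma'$ then $\chi(\Gamma)\vdash_{\Sigma'}\chi(\Phi)$. - Reflexivity, symmetry and transitivity of $=$; congruence of $=$ for every $\sigma\in F$; if $\Gamma\vdash t_1=t_1'$, $\Gamma\vdash t_2=t_2'$ and $\Gamma\vdash t_1\stackrel\lambda\Rightarrow t_2$ then $\Gamma\vdash t_1'\stackrel\lambda\Rightarrow t_2'$; if $f\in M$ and $\Gamma\vdash t_j\stackrel\lambda\Rightarrow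 u_j$ then $\Gamma\vdash f(t_1,\dots,t_j,\dots,t_n)\stackrel\lambda\Rightarrow f(t_1,\dots,u_j,\dots,t_n)$. - If $\Gamma\vdash t_1\stackrel{\mathfrak a_1}\Rightarrow t$ and $\Gamma\vdash t\stackrel{\mathfrak a_2}\Rightarrow t_2$ then $\Gamma\vdash t_1\stackrel{\mathfrak a_1;\mathfrak a_2}\Longrightarrow t_2$. If $\Gamma\vdash_\Sigma t_1\stackrel{\mathfrak a_1;\mathfrak a_2}\Longrightarrow t_2$ and $\Gamma\cup\{t_1\stackrel{\mathfrak a_1}\Rightarrow x,\ x\stackrel{\mathfrak a_2}\Rightarrow t_2\}\vdash_{\Sigma[x]}\phi$ then $\Gamma\vdash_\Sigma\phi$. - If $\Gamma\vdash t_1\stackrel{\mathfrak a_i}\Rightarrow t_2$ for $i=1$ or $i=2$ then $\Gamma\vdash t_1\stackrel{\mathfrak a_1\cup\mathfrak a_2}\Longrightarrow t_2$. If $\Gamma\vdash t_1\stackrel{\mathfrak a_1\cup\mathfrak a_2}\Longrightarrow t_2$ and $\Gamma\cup\{t_1\stackrel{\mathfrak a_i}\Rightarrow t_2\}\vdash\phi$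 for both $i\in\{1,2\}$ then $\Gamma\vdash\phi$. - If $\Gamma\vdash t_1\stackrel{\mathfrak a^n}\Rightarrow t_2$ for some $n\in\omega$ then $\Gamma\vdash t_1\stackrel{\mathfrak a^*}\Rightarrow t_2$. If $\Gamma\vdash t_1\stackrel{\mathfrak a^*}\Rightarrow t_2$ and $\Gamma\cup\{t_1\stackrel{\mathfrak a^n}\Rightarrow t_2\}\vdash\phi$ for all $n\in\omega$ then $\Gamma\vdash\phi$. (Here $t_1\stackrel{\mathfrak a^0}\Rightarrow t_2$ is $t_1=t_2$, $\mathfrak a^1=\mathfrak a$ and $\mathfrak a^{n+1}=\mathfrak a;\mathfrak a^n$ for $n\ge1$.) - If $\Gamma\vdash\neg\neg\phi$ then $\Gamma\vdash\phi$; if $\Gamma\vdash\bot$ then $\Gamma\vdash\phi$; if $\Gamma\cup\{\phi\}\vdash\bot$ then $\Gamma\vdash\neg\phi$; if $\Gamma\vdash\neg\phi$ then $\Gamma\cup\{\phi\}\vdash\bot$; if $\Gamma\vdash\phi$ and $\phi\in\Phi$ then $\Gamma\vdash\bigvee\Phi$; if $\Gamma\vdash\bigvee\Phi$ and $\Gamma\cup\{\phi\}\vdash\gamma$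 for all $\phi\in\Phi$ then $\Gamma\vdash\gamma$. - $\Gamma\cup\{\phi\}\vdash_{\Sigma[X]}\gamma$ if and only if $\Gamma\cup\{\exists X\cdot\phi\}\vdash_\Sigma\gamma$ (a rule in each direction); if $\Gamma\vdash\theta(\phi)$ for a substitution $\theta$ of ground $\Sigma$-terms for the variables in $X$, then $\Gamma\vdash\exists X\cdot\phi$. -/

import Mathlib

universe u

namespace TransitionAlgebra

/-- Signatures `(S, F ⊇ M, L)`. A word `w ∈ S*` of length `n` is a function `Fin n → S`;
`Fn n w s` is the set `F_{w,s}`, `Mono` its subset `M_{w,s}` of monotonic symbols,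
`Label` the set of transition labels. -/
structure Signature where
  Sorts : Type u
  Fn : (n : ℕ) → (Fin n → Sorts) → Sorts → Type u
  Mono : {n : ℕ} → {w : Fin n → Sorts} → {s : Sorts} → Set (Fn n w s)
  Label : Type u

/-- A signature is (at most) countable if it has countably many sorts, function declarations
`σ : w → s` and labels. -/
def Signature.IsCountable (Sg : Signature.{u}) : Prop :=
  Countable Sg.Sorts ∧
  Countable (Σ (n : ℕ) (w : Fin n → Sg.Sorts) (s : Sg.Sorts), Sg.Fn n w s) ∧
  Countable Sg.Label

/-- Signature morphisms: an algebraic signature morphism that preserves monotonic symbols,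
together with a map of labels. -/
structure Hom (Sg Sg' : Signature.{u}) where
  sort : Sg.Sorts → Sg'.Sorts
  fn : {n : ℕ} → {w : Fin n → Sg.Sorts} → {s : Sg.Sorts} →
    Sg.Fn n w s → Sg'.Fn n (fun i => sort (w i)) (sort s)
  mono : ∀ {n : ℕ} {w : Fin n → Sg.Sorts} {s : Sg.Sorts} (σ : Sg.Fn n w s),
    σ ∈ Sg.Mono → fn σ ∈ Sg'.Mono
  lab : Sg.Label → Sg'.Label

/-- A finite set of variables: finitely many variable names `v_i` (the name `v_i` is given by
its index `i`), each with a sort. Distinct variables have distinct names. -/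
structure VarSet (S : Type u) where
  names : Finset ℕ
  sort : names → S

/-- The set consisting of the single variable `v_i` of sort `s`. -/
abbrev VarSet.single {S : Type u} (i : ℕ) (s : S) : VarSet S where
  names := {i}
  sort := fun _ => s

/-- Translation of variables along a map of sorts: names are kept, sorts are translated. -/
abbrev VarSet.map {S S' : Type u} (X : VarSet S) (f : S → S') : VarSet S' where
  names := X.names
  sort := fun x => f (X.sort x)

/-- The function symbols of `Σ[X]`: those of `Σ`, and each variable `x ∈ X` as a new constant
(symbol of the empty arity, that is, of the unique `w : Fin 0 → S`) of its sort. The union is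
disjoint. -/
inductive ExtFn {S : Type u} (F : (n : ℕ) → (Fin n → S) → S → Type u) (X : VarSet S) :
    (n : ℕ) → (Fin n → S) → S → Type u
  | old {n : ℕ} {w : Fin n → S} {s : S} (σ : F n w s) : ExtFn F X n w s
  | var (x : X.names) (w : Fin 0 → S) : ExtFn F X 0 w (X.sort x)

/-- The signature `Σ[X]`. -/
abbrev Signature.extend (Sg : Signature.{u}) (X : VarSet Sg.Sorts) : Signature.{u} where
  Sorts := Sg.Sorts
  Fn := ExtFn Sg.Fn X
  Mono := {τ | ∃ σ ∈ Sg.Mono, τ = ExtFn.old σ}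
  Label := Sg.Label

/-- The inclusion `ι_X : Σ → Σ[X]`. -/
abbrev Hom.incl (Sg : Signature.{u}) (X : VarSet Sg.Sorts) : Hom Sg (Sg.extend X) where
  sort := fun s => s
  fn := fun σ => ExtFn.old σ
  mono := fun σ hσ => ⟨σ, hσ, rfl⟩
  lab := fun l => l

/-- The extension `χ' : Σ[X] → Σ'[X']` of `χ : Σ → Σ'`, mapping each variable of `X` to the
variable of `X'` with the same name. -/
abbrev Hom.extend {Sg Sg' : Signature.{u}} (χ : Hom Sg Sg') (X : VarSet Sg.Sorts) :
    Hom (Sg.extend X) (Sg'.extend (X.map χ.sort)) where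
  sort := χ.sort
  fn := fun τ => match τ with
    | ExtFn.old σ => ExtFn.old (χ.fn σ)
    | ExtFn.var x w =>
        ExtFn.var (F := Sg'.Fn) (X := X.map χ.sort) x (fun i => χ.sort (w i))
  mono := by
    rintro n w s _ ⟨σ, hσ, rfl⟩
    exact ⟨χ.fn σ, χ.mono σ hσ, rfl⟩
  lab := χ.lab

/-! ### Models -/

/-- `Σ`-models; carriers may be empty. -/
structure Model (Sg : Signature.{u}) where
  carrier : Sg.Sorts → Type u
  fn : {n : ℕ} → {w : Fin n → Sg.Sorts} → {s : Sg.Sorts} →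
    Sg.Fn n w s → (∀ i, carrier (w i)) → carrier s
  rel : Sg.Label → (s : Sg.Sorts) → carrier s → carrier s → Prop
  mono : ∀ {n : ℕ} {w : Fin n → Sg.Sorts} {s : Sg.Sorts} (σ : Sg.Fn n w s), σ ∈ Sg.Mono →
    ∀ (l : Sg.Label) (a : ∀ i, carrier (w i)) (k : Fin n) (b : carrier (w k)),
      rel l (w k) (a k) b → rel l s (fn σ a) (fn σ (Function.update a k b))

/-- A model is (at most) countable if the disjoint union of its carriers is. -/
def Model.IsCountable {Sg : Signature.{u}} (A : Model Sg) : Prop :=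
  Countable (Σ s : Sg.Sorts, A.carrier s)

/-- The expansion of `A` to `Σ[X]` that interprets the variables by the valuation `g`. Every
expansion of `A` along the inclusion `Σ → Σ[X]` is of this form for exactly one `g`. -/
abbrev Model.expand {Sg : Signature.{u}} (A : Model Sg) {X : VarSet Sg.Sorts}
    (g : ∀ x : X.names, A.carrier (X.sort x)) : Model (Sg.extend X) where
  carrier := A.carrier
  fn := fun τ => match τ with
    | ExtFn.old σ => A.fn σ
    | ExtFn.var x _ => fun _ => g x
  rel := A.rel
  mono := by
    rintro n w s _ ⟨σ, hσ, rfl⟩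
    exact A.mono σ hσ

/-! ### Terms, actions, sentences -/

/-- Ground terms over the function symbols of a signature. -/
inductive Term (Sg : Signature.{u}) : Sg.Sorts → Type u
  | app {n : ℕ} {w : Fin n → Sg.Sorts} {s : Sg.Sorts} (σ : Sg.Fn n w s)
      (ts : ∀ i, Term Sg (w i)) : Term Sg s

/-- The interpretation of a term in a model. -/
def Term.eval {Sg : Signature.{u}} (A : Model Sg) : {s : Sg.Sorts} → Term Sg s → A.carrier s
  | _, .app σ ts => A.fn σ (fun i => (ts i).eval A)

/-- The translation of terms along a signature morphism. -/
def Term.map {Sg Sg' : Signature.{u}} (χ : Hom Sg Sg') :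
    {s : Sg.Sorts} → Term Sg s → Term Sg' (χ.sort s)
  | _, .app σ ts => .app (χ.fn σ) (fun i => (ts i).map χ)

/-- The variable `x ∈ X`, as a term over `Σ[X]`. -/
def Term.var {Sg : Signature.{u}} {X : VarSet Sg.Sorts} (x : X.names) :
    Term (Sg.extend X) (X.sort x) :=
  .app (Sg := Sg.extend X) (ExtFn.var x Fin.elim0) (fun i => i.elim0)

/-- Actions over a set of labels. -/
inductive Action (L : Type u) : Type u
  | lab (l : L) : Action L
  | comp (a b : Action L) : Action L
  | union (a b : Action L) : Action L
  | star (a : Action L) : Action L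

/-- The translation of actions along a map of labels. -/
def Action.map {L L' : Type u} (f : L → L') : Action L → Action L'
  | .lab l => .lab (f l)
  | .comp a b => .comp (a.map f) (b.map f)
  | .union a b => .union (a.map f) (b.map f)
  | .star a => .star (a.map f)

/-- The iterated composition `a^(n+1)`. -/
def Action.powSucc {L : Type u} (a : Action L) : ℕ → Action L
  | 0 => a
  | n + 1 => .comp a (a.powSucc n)

/-- The interpretation of an action in a model. -/
def Model.act {Sg : Signature.{u}} (A : Model Sg) :
    Action Sg.Label → (s : Sg.Sorts) → A.carrier s → A.carrier s → Prop
  | .lab l, s => A.rel l s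
  | .comp a b, s => Relation.Comp (A.act a s) (A.act b s)
  | .union a b, s => fun x y => A.act a s x y ∨ A.act b s x y
  | .star a, s => Relation.ReflTransGen (A.act a s)

/-- The sentences over a signature. The finite disjunction is taken over a finite family; in
`ex X φ`, the sentence `φ` is a sentence over `Σ[X]`. -/
inductive Sentence : Signature.{u} → Type (u + 1)
  | eq {Sg : Signature.{u}} {s : Sg.Sorts} (t₁ t₂ : Term Sg s) : Sentence Sg
  | trans {Sg : Signature.{u}} {s : Sg.Sorts} (t₁ : Term Sg s) (a : Action Sg.Label)
      (t₂ : Term Sg s) : Sentence Sg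
  | neg {Sg : Signature.{u}} (φ : Sentence Sg) : Sentence Sg
  | disj {Sg : Signature.{u}} {n : ℕ} (Φ : Fin n → Sentence Sg) : Sentence Sg
  | ex {Sg : Signature.{u}} (X : VarSet Sg.Sorts) (φ : Sentence (Sg.extend X)) : Sentence Sg

/-- Falsity is the empty disjunction. -/
def Sentence.bot (Sg : Signature.{u}) : Sentence Sg :=
  .disj (n := 0) Fin.elim0

/-- The sentence `t₁ ⇒ t₂` labelled by `a^n`, which for `n = 0` is the equation `t₁ = t₂`. -/
def Sentence.transPow {Sg : Signature.{u}} {s : Sg.Sorts} (t₁ : Term Sg s)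
    (a : Action Sg.Label) (t₂ : Term Sg s) : ℕ → Sentence Sg
  | 0 => .eq t₁ t₂
  | n + 1 => .trans t₁ (a.powSucc n) t₂

/-- The satisfaction relation `A ⊨ φ`. -/
def Sat : {Sg : Signature.{u}} → Sentence Sg → Model Sg → Prop
  | _, .eq t₁ t₂, A => t₁.eval A = t₂.eval A
  | _, .trans t₁ a t₂, A => A.act a _ (t₁.eval A) (t₂.eval A)
  | _, .neg φ, A => ¬ Sat φ A
  | _, .disj Φ, A => ∃ i, Sat (Φ i) A
  | _, .ex X φ, A => ∃ g : ∀ x : X.names, A.carrier (X.sort x), Sat φ (A.expand g)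

/-- `A ⊨ Γ`. -/
def Model.Satisfies {Sg : Signature.{u}} (A : Model Sg) (Γ : Set (Sentence Sg)) : Prop :=
  ∀ φ ∈ Γ, Sat φ A

/-- The translation of sentences along a signature morphism. -/
def Sentence.map : {Sg : Signature.{u}} → Sentence Sg → {Sg' : Signature.{u}} →
    Hom Sg Sg' → Sentence Sg'
  | _, .eq t₁ t₂, _, χ => .eq (t₁.map χ) (t₂.map χ)
  | _, .trans t₁ a t₂, _, χ => .trans (t₁.map χ) (a.map χ.lab) (t₂.map χ)
  | _, .neg φ, _, χ => .neg (φ.map χ)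
  | _, .disj Φ, _, χ => .disj (fun i => (Φ i).map χ)
  | _, .ex X φ, _, χ => .ex (X.map χ.sort) (φ.map (χ.extend X))

/-- The translation of a sentence along the inclusion `Σ → Σ[X]`. -/
def Sentence.lift {Sg : Signature.{u}} (X : VarSet Sg.Sorts) (φ : Sentence Sg) :
    Sentence (Sg.extend X) :=
  φ.map (Hom.incl Sg X)

/-! ### Substitutions

A substitution `θ : X → T_Σ` replaces constants of `Σ[X]` by terms. To pass under quantifiers it
is seen as a map from `Σ[X]` to `Σ` that sends a function symbol to a function symbol, or, if it
is a constant, possibly to a term. -/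

/-- The possible images of a symbol of arity `w` and sort `s`: a function symbol of that arity
and sort or, if the arity is empty, a term of that sort. -/
inductive Op (Sg : Signature.{u}) : (n : ℕ) → (Fin n → Sg.Sorts) → Sg.Sorts → Type u
  | symb {n : ℕ} {w : Fin n → Sg.Sorts} {s : Sg.Sorts} (σ : Sg.Fn n w s) : Op Sg n w s
  | term {s : Sg.Sorts} (t : Term Sg s) (w : Fin 0 → Sg.Sorts) : Op Sg 0 w s

/-- The application of such an image to argument terms. -/
def Op.app {Sg : Signature.{u}} {n : ℕ} {w : Fin n → Sg.Sorts} {s : Sg.Sorts} :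
    Op Sg n w s → (∀ i, Term Sg (w i)) → Term Sg s
  | .symb σ, ts => .app σ ts
  | .term t _, _ => t

/-- The translation of such images along the inclusion `Σ → Σ[X]`. -/
def Op.lift {Sg : Signature.{u}} (X : VarSet Sg.Sorts) {n : ℕ} {w : Fin n → Sg.Sorts}
    {s : Sg.Sorts} : Op Sg n w s → Op (Sg.extend X) n w s
  | .symb σ => .symb (Sg := Sg.extend X) (ExtFn.old σ)
  | .term t w => .term (Sg := Sg.extend X) (t.map (Hom.incl Sg X)) w

/-- Maps of signatures that may send constants to terms. -/
structure Subst (Sg Sg' : Signature.{u}) where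
  sort : Sg.Sorts → Sg'.Sorts
  fn : {n : ℕ} → {w : Fin n → Sg.Sorts} → {s : Sg.Sorts} →
    Sg.Fn n w s → Op Sg' n (fun i => sort (w i)) (sort s)
  lab : Sg.Label → Sg'.Label

/-- The extension of a substitution by variables that it leaves unchanged. -/
abbrev Subst.extend {Sg Sg' : Signature.{u}} (θ : Subst Sg Sg') (X : VarSet Sg.Sorts) :
    Subst (Sg.extend X) (Sg'.extend (X.map θ.sort)) where
  sort := θ.sort
  fn := fun τ => match τ with
    | ExtFn.old σ => (θ.fn σ).lift (X.map θ.sort)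
    | ExtFn.var x w => .symb (Sg := Sg'.extend (X.map θ.sort))
        (ExtFn.var (F := Sg'.Fn) (X := X.map θ.sort) x (fun i => θ.sort (w i)))
  lab := θ.lab

/-- The map `Σ[X] → Σ` given by `θ : X → T_Σ`; it is the identity on `Σ`. -/
abbrev Subst.ofTerms {Sg : Signature.{u}} {X : VarSet Sg.Sorts}
    (θ : ∀ x : X.names, Term Sg (X.sort x)) : Subst (Sg.extend X) Sg where
  sort := fun s => s
  fn := fun τ => match τ with
    | ExtFn.old σ => .symb σ
    | ExtFn.var x w => .term (θ x) w
  lab := fun l => l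

/-- The action of a substitution on terms. -/
def Term.subst {Sg Sg' : Signature.{u}} (θ : Subst Sg Sg') :
    {s : Sg.Sorts} → Term Sg s → Term Sg' (θ.sort s)
  | _, .app σ ts => (θ.fn σ).app (fun i => (ts i).subst θ)

/-- The action of a substitution on sentences. -/
def Sentence.subst : {Sg : Signature.{u}} → Sentence Sg → {Sg' : Signature.{u}} →
    Subst Sg Sg' → Sentence Sg'
  | _, .eq t₁ t₂, _, θ => .eq (t₁.subst θ) (t₂.subst θ)
  | _, .trans t₁ a t₂, _, θ => .trans (t₁.subst θ) (a.map θ.lab) (t₂.subst θ)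
  | _, .neg φ, _, θ => .neg (φ.subst θ)
  | _, .disj Φ, _, θ => .disj (fun i => (Φ i).subst θ)
  | _, .ex X φ, _, θ => .ex (X.map θ.sort) (φ.subst (θ.extend X))

/-! ### Entailment -/

/-- The dynamic entailment relation `Γ ⊢_Σ Φ` between sets of sentences: the least family of
relations, indexed by all signatures, closed under the following rules. `Γ ⊢ φ` is
`Γ ⊢ {φ}`. -/
inductive Entails : (Sg : Signature.{u}) → Set (Sentence Sg) → Set (Sentence Sg) → Prop
  -- Entailment relations
  | monotonicity {Sg : Signature.{u}} {Γ Φ : Set (Sentence Sg)} (h : Φ ⊆ Γ) : Entails Sg Γ Φ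
  | transitivity {Sg : Signature.{u}} {Γ Φ Ψ : Set (Sentence Sg)}
      (h₁ : Entails Sg Γ Φ) (h₂ : Entails Sg Φ Ψ) : Entails Sg Γ Ψ
  | union {Sg : Signature.{u}} {Γ Φ : Set (Sentence Sg)}
      (h : ∀ φ ∈ Φ, Entails Sg Γ {φ}) : Entails Sg Γ Φ
  | translation {Sg Sg' : Signature.{u}} (χ : Hom Sg Sg') {Γ Φ : Set (Sentence Sg)}
      (h : Entails Sg Γ Φ) :
      Entails Sg' ((fun φ => φ.map χ) '' Γ) ((fun φ => φ.map χ) '' Φ)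
  -- Equations and labelled transitions
  | refl {Sg : Signature.{u}} {Γ : Set (Sentence Sg)} {s : Sg.Sorts} (t : Term Sg s) :
      Entails Sg Γ {.eq t t}
  | symm {Sg : Signature.{u}} {Γ : Set (Sentence Sg)} {s : Sg.Sorts} {t₁ t₂ : Term Sg s}
      (h : Entails Sg Γ {.eq t₁ t₂}) : Entails Sg Γ {.eq t₂ t₁}
  | trans {Sg : Signature.{u}} {Γ : Set (Sentence Sg)} {s : Sg.Sorts} {t₁ t₂ t₃ : Term Sg s}
      (h₁ : Entails Sg Γ {.eq t₁ t₂}) (h₂ : Entails Sg Γ {.eq t₂ t₃}) :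
      Entails Sg Γ {.eq t₁ t₃}
  | congr {Sg : Signature.{u}} {Γ : Set (Sentence Sg)} {n : ℕ} {w : Fin n → Sg.Sorts}
      {s : Sg.Sorts} (σ : Sg.Fn n w s) {t t' : ∀ i, Term Sg (w i)}
      (h : ∀ i, Entails Sg Γ {.eq (t i) (t' i)}) :
      Entails Sg Γ {.eq (.app σ t) (.app σ t')}
  | pred {Sg : Signature.{u}} {Γ : Set (Sentence Sg)} {s : Sg.Sorts}
      {t₁ t₁' t₂ t₂' : Term Sg s} {l : Sg.Label}
      (h₁ : Entails Sg Γ {.eq t₁ t₁'}) (h₂ : Entails Sg Γ {.eq t₂ t₂'})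
      (h : Entails Sg Γ {.trans t₁ (.lab l) t₂}) : Entails Sg Γ {.trans t₁' (.lab l) t₂'}
  | mono {Sg : Signature.{u}} {Γ : Set (Sentence Sg)} {n : ℕ} {w : Fin n → Sg.Sorts}
      {s : Sg.Sorts} (f : Sg.Fn n w s) (hf : f ∈ Sg.Mono) {l : Sg.Label}
      (t : ∀ i, Term Sg (w i)) (j : Fin n) (u : Term Sg (w j))
      (h : Entails Sg Γ {.trans (t j) (.lab l) u}) :
      Entails Sg Γ {.trans (.app f t) (.lab l) (.app f (Function.update t j u))}
  -- Actions
  | comp_intro {Sg : Signature.{u}} {Γ : Set (Sentence Sg)} {s : Sg.Sorts}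
      {t₁ t t₂ : Term Sg s} {a₁ a₂ : Action Sg.Label}
      (h₁ : Entails Sg Γ {.trans t₁ a₁ t}) (h₂ : Entails Sg Γ {.trans t a₂ t₂}) :
      Entails Sg Γ {.trans t₁ (.comp a₁ a₂) t₂}
  | comp_elim {Sg : Signature.{u}} {Γ : Set (Sentence Sg)} {s : Sg.Sorts}
      {t₁ t₂ : Term Sg s} {a₁ a₂ : Action Sg.Label} {φ : Sentence Sg} (i : ℕ)
      (h₁ : Entails Sg Γ {.trans t₁ (.comp a₁ a₂) t₂})
      (h₂ : Entails (Sg.extend (VarSet.single i s))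
        (Sentence.lift (VarSet.single i s) '' Γ ∪
          {Sentence.trans (Sg := Sg.extend (VarSet.single i s))
              (t₁.map (Hom.incl Sg (VarSet.single i s))) a₁
              (Term.var (Sg := Sg) (X := VarSet.single i s) ⟨i, Finset.mem_singleton_self i⟩),
            Sentence.trans (Sg := Sg.extend (VarSet.single i s))
              (Term.var (Sg := Sg) (X := VarSet.single i s) ⟨i, Finset.mem_singleton_self i⟩)
              a₂ (t₂.map (Hom.incl Sg (VarSet.single i s)))})
        {φ.lift (VarSet.single i s)}) :
      Entails Sg Γ {φ}
  | union_intro_left {Sg : Signature.{u}} {Γ : Set (Sentence Sg)} {s : Sg.Sorts}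
      {t₁ t₂ : Term Sg s} {a₁ a₂ : Action Sg.Label} (h : Entails Sg Γ {.trans t₁ a₁ t₂}) :
      Entails Sg Γ {.trans t₁ (.union a₁ a₂) t₂}
  | union_intro_right {Sg : Signature.{u}} {Γ : Set (Sentence Sg)} {s : Sg.Sorts}
      {t₁ t₂ : Term Sg s} {a₁ a₂ : Action Sg.Label} (h : Entails Sg Γ {.trans t₁ a₂ t₂}) :
      Entails Sg Γ {.trans t₁ (.union a₁ a₂) t₂}
  | union_elim {Sg : Signature.{u}} {Γ : Set (Sentence Sg)} {s : Sg.Sorts}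
      {t₁ t₂ : Term Sg s} {a₁ a₂ : Action Sg.Label} {φ : Sentence Sg}
      (h : Entails Sg Γ {.trans t₁ (.union a₁ a₂) t₂})
      (h₁ : Entails Sg (Γ ∪ {.trans t₁ a₁ t₂}) {φ})
      (h₂ : Entails Sg (Γ ∪ {.trans t₁ a₂ t₂}) {φ}) : Entails Sg Γ {φ}
  | star_intro {Sg : Signature.{u}} {Γ : Set (Sentence Sg)} {s : Sg.Sorts}
      {t₁ t₂ : Term Sg s} {a : Action Sg.Label} (n : ℕ)
      (h : Entails Sg Γ {Sentence.transPow t₁ a t₂ n}) : Entails Sg Γ {.trans t₁ (.star a) t₂}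
  | star_elim {Sg : Signature.{u}} {Γ : Set (Sentence Sg)} {s : Sg.Sorts}
      {t₁ t₂ : Term Sg s} {a : Action Sg.Label} {φ : Sentence Sg}
      (h : Entails Sg Γ {.trans t₁ (.star a) t₂})
      (hn : ∀ n : ℕ, Entails Sg (Γ ∪ {Sentence.transPow t₁ a t₂ n}) {φ}) : Entails Sg Γ {φ}
  -- Boolean connectives
  | neg_double {Sg : Signature.{u}} {Γ : Set (Sentence Sg)} {φ : Sentence Sg}
      (h : Entails Sg Γ {φ.neg.neg}) : Entails Sg Γ {φ}
  | false_elim {Sg : Signature.{u}} {Γ : Set (Sentence Sg)} {φ : Sentence Sg}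
      (h : Entails Sg Γ {Sentence.bot Sg}) : Entails Sg Γ {φ}
  | neg_intro {Sg : Signature.{u}} {Γ : Set (Sentence Sg)} {φ : Sentence Sg}
      (h : Entails Sg (Γ ∪ {φ}) {Sentence.bot Sg}) : Entails Sg Γ {φ.neg}
  | neg_elim {Sg : Signature.{u}} {Γ : Set (Sentence Sg)} {φ : Sentence Sg}
      (h : Entails Sg Γ {φ.neg}) : Entails Sg (Γ ∪ {φ}) {Sentence.bot Sg}
  | disj_intro {Sg : Signature.{u}} {Γ : Set (Sentence Sg)} {n : ℕ} {Φ : Fin n → Sentence Sg}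
      (i : Fin n) (h : Entails Sg Γ {Φ i}) : Entails Sg Γ {.disj Φ}
  | disj_elim {Sg : Signature.{u}} {Γ : Set (Sentence Sg)} {n : ℕ} {Φ : Fin n → Sentence Sg}
      {γ : Sentence Sg} (h : Entails Sg Γ {.disj Φ})
      (hi : ∀ i, Entails Sg (Γ ∪ {Φ i}) {γ}) : Entails Sg Γ {γ}
  -- Quantifiers
  | quant_intro {Sg : Signature.{u}} {Γ : Set (Sentence Sg)} {X : VarSet Sg.Sorts}
      {φ : Sentence (Sg.extend X)} {γ : Sentence Sg}
      (h : Entails (Sg.extend X) (Sentence.lift X '' Γ ∪ {φ}) {γ.lift X}) :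
      Entails Sg (Γ ∪ {.ex X φ}) {γ}
  | quant_elim {Sg : Signature.{u}} {Γ : Set (Sentence Sg)} {X : VarSet Sg.Sorts}
      {φ : Sentence (Sg.extend X)} {γ : Sentence Sg}
      (h : Entails Sg (Γ ∪ {.ex X φ}) {γ}) :
      Entails (Sg.extend X) (Sentence.lift X '' Γ ∪ {φ}) {γ.lift X}
  | subst {Sg : Signature.{u}} {Γ : Set (Sentence Sg)} {X : VarSet Sg.Sorts}
      {φ : Sentence (Sg.extend X)} (θ : ∀ x : X.names, Term Sg (X.sort x))
      (h : Entails Sg Γ {φ.subst (Subst.ofTerms θ)}) : Entails Sg Γ {.ex X φ}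

/-- `Γ` is consistent if it does not entail falsity. -/
def Consistent {Sg : Signature.{u}} (Γ : Set (Sentence Sg)) : Prop :=
  ¬ Entails Sg Γ {Sentence.bot Sg}

end TransitionAlgebra

/-!
The model is built by forcing. The conditions are consistent sets of sentences over `Σ` with
finitely many new constants, ordered by inclusion. Compactness is not available, because the
elimination rule for `a*` has infinitely many premises, and the constants cannot be added all at
once, because carriers may be empty and a constant asserts that its sort is inhabited. Both
obstacles disappear for a single condition: if it entails a sentence, then it extends to a
condition that entails a witness for the outermost connective of the sentence (a disjunct, a power
of `a` for a transition labelled `a*`, an intermediate term for a composition, an instance by new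
constants for a quantifier), since otherwise the elimination rule for this connective would make
the condition inconsistent (`Condition.exists_witnessed`). New constants are as good as variables,
because the morphism that names the variables by them has a retraction
(`Condition.exists_instantiate`).

Over a countable signature there are only countably many sentences (`countable_sentence`), and the
Rasiowa–Sikorski lemma provides an ideal of conditions that contains the given theory and decides
for each sentence whether it has a witness (`exists_isGeneric`). The terms over the constants known
to this ideal, up to equality forced by it, form a countable model, in which a sentence holds if and
only if it is forced (`sat_iff_forced`).

Instances of quantified sentences are always taken by constants, that is, along signature
morphisms, so that the functoriality of `Sentence.map` and the satisfaction condition `sat_map` take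
the place of a substitution calculus. This loses nothing, because `∃ x · t = x` is derivable for
every term `t` (`Entails.exists_eq`).
-/

namespace TransitionAlgebra

/-! ### Functoriality of the translation of sentences and the satisfaction condition -/

/-- The identity morphism. -/
abbrev Hom.id (Sg : Signature.{u}) : Hom Sg Sg where
  sort := fun s => s
  fn := fun σ => σ
  mono := fun _ h => h
  lab := fun l => l

/-- The composite of signature morphisms, first `χ` and then `ψ`. -/
abbrev Hom.comp {Sg Sg' Sg'' : Signature.{u}} (ψ : Hom Sg' Sg'') (χ : Hom Sg Sg') :
    Hom Sg Sg'' where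
  sort := fun s => ψ.sort (χ.sort s)
  fn := fun σ => ψ.fn (χ.fn σ)
  mono := fun σ h => ψ.mono _ (χ.mono σ h)
  lab := fun l => ψ.lab (χ.lab l)

/-- Morphisms that agree definitionally on sorts and labels are equal if they agree on function
symbols; no transport along an equality of sort maps occurs. -/
theorem Hom.ext_fn {Sg Sg' : Signature.{u}} {f : Sg.Sorts → Sg'.Sorts} {g : Sg.Label → Sg'.Label}
    {F F' : {n : ℕ} → {w : Fin n → Sg.Sorts} → {s : Sg.Sorts} →
      Sg.Fn n w s → Sg'.Fn n (fun i => f (w i)) (f s)} {m m'}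
    (h : ∀ (n : ℕ) (w : Fin n → Sg.Sorts) (s : Sg.Sorts) (σ : Sg.Fn n w s), F σ = F' σ) :
    (⟨f, F, m, g⟩ : Hom Sg Sg') = ⟨f, F', m', g⟩ := by
  have : @F = @F' := by
    funext n w s σ
    exact h n w s σ
  subst this
  rfl

theorem Term.map_id {Sg : Signature.{u}} {s : Sg.Sorts} (t : Term Sg s) :
    t.map (Hom.id Sg) = t := by
  induction t with
  | app σ ts ih => simp only [Term.map, ih]

theorem Term.map_comp {Sg Sg' Sg'' : Signature.{u}} (χ : Hom Sg Sg') (ψ : Hom Sg' Sg'')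
    {s : Sg.Sorts} (t : Term Sg s) : (t.map χ).map ψ = t.map (ψ.comp χ) := by
  induction t with
  | app σ ts ih => simp only [Term.map, ih]

theorem Action.map_id {L : Type u} (a : Action L) : a.map (fun l => l) = a := by
  induction a <;> simp_all [Action.map]

theorem Action.map_comp {L L' L'' : Type u} (f : L → L') (g : L' → L'') (a : Action L) :
    (a.map f).map g = a.map (fun l => g (f l)) := by
  induction a <;> simp_all [Action.map]

theorem Hom.extend_id {Sg : Signature.{u}} (X : VarSet Sg.Sorts) :
    (Hom.id Sg).extend X = Hom.id (Sg.extend X) :=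
  Hom.ext_fn fun _ _ _ σ => by cases σ <;> rfl

theorem Hom.extend_comp {Sg Sg' Sg'' : Signature.{u}} (χ : Hom Sg Sg') (ψ : Hom Sg' Sg'')
    (X : VarSet Sg.Sorts) :
    (ψ.extend (X.map χ.sort)).comp (χ.extend X) = (ψ.comp χ).extend X :=
  Hom.ext_fn fun _ _ _ σ => by cases σ <;> rfl

theorem Sentence.map_id {Sg : Signature.{u}} (φ : Sentence Sg) : φ.map (Hom.id Sg) = φ := by
  induction φ with
  | eq t u => simp only [Sentence.map, Term.map_id]
  | trans t a u => simp only [Sentence.map, Term.map_id, Action.map_id]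
  | neg φ ih => simp only [Sentence.map, ih]
  | disj Φ ih => simp only [Sentence.map, ih]
  | ex X φ ih =>
    simp only [Sentence.map]
    rw [Hom.extend_id, ih]

theorem Sentence.map_comp {Sg Sg' Sg'' : Signature.{u}} (χ : Hom Sg Sg') (ψ : Hom Sg' Sg'')
    (φ : Sentence Sg) : (φ.map χ).map ψ = φ.map (ψ.comp χ) := by
  induction φ generalizing Sg' Sg'' with
  | eq t u => simp only [Sentence.map, Term.map_comp]
  | trans t a u => simp only [Sentence.map, Term.map_comp, Action.map_comp]
  | neg φ ih => simp only [Sentence.map, ih]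
  | disj Φ ih => simp only [Sentence.map, ih]
  | ex X φ ih =>
    simp only [Sentence.map]
    rw [ih, Hom.extend_comp]

theorem Sentence.map_bot {Sg Sg' : Signature.{u}} (χ : Hom Sg Sg') :
    (Sentence.bot Sg).map χ = Sentence.bot Sg' := by
  simp only [Sentence.bot, Sentence.map]
  congr 1
  funext i
  exact i.elim0

theorem Action.map_powSucc {L L' : Type u} (f : L → L') (a : Action L) (n : ℕ) :
    (a.powSucc n).map f = (a.map f).powSucc n := by
  induction n with
  | zero => rfl
  | succ n ih => simp only [Action.powSucc, Action.map, ih]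

theorem Sentence.map_transPow {Sg Sg' : Signature.{u}} (χ : Hom Sg Sg') {s : Sg.Sorts}
    (t u : Term Sg s) (a : Action Sg.Label) (n : ℕ) :
    (Sentence.transPow t a u n).map χ =
      Sentence.transPow (t.map χ) (a.map χ.lab) (u.map χ) n := by
  cases n with
  | zero => rfl
  | succ n => simp only [Sentence.transPow, Sentence.map, Action.map_powSucc]

/-- The reduct of a model along a signature morphism. -/
abbrev Model.reduct {Sg Sg' : Signature.{u}} (A : Model Sg') (χ : Hom Sg Sg') : Model Sg where
  carrier := fun s => A.carrier (χ.sort s)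
  fn := fun σ => A.fn (χ.fn σ)
  rel := fun l s => A.rel (χ.lab l) (χ.sort s)
  mono := fun σ h l a k b => A.mono (χ.fn σ) (χ.mono σ h) (χ.lab l) a k b

theorem Model.ext_fn {Sg : Signature.{u}} {C : Sg.Sorts → Type u}
    {R : Sg.Label → (s : Sg.Sorts) → C s → C s → Prop}
    {F F' : {n : ℕ} → {w : Fin n → Sg.Sorts} → {s : Sg.Sorts} →
      Sg.Fn n w s → (∀ i, C (w i)) → C s} {m m'}
    (h : ∀ (n : ℕ) (w : Fin n → Sg.Sorts) (s : Sg.Sorts) (σ : Sg.Fn n w s) (a : ∀ i, C (w i)),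
      F σ a = F' σ a) :
    (⟨C, F, R, m⟩ : Model Sg) = ⟨C, F', R, m'⟩ := by
  have : @F = @F' := by
    funext n w s σ a
    exact h n w s σ a
  subst this
  rfl

theorem Model.reduct_expand {Sg Sg' : Signature.{u}} (A : Model Sg') (χ : Hom Sg Sg')
    (X : VarSet Sg.Sorts) (g : ∀ x : X.names, A.carrier (χ.sort (X.sort x))) :
    (A.expand (X := X.map χ.sort) g).reduct (χ.extend X) = (A.reduct χ).expand g :=
  Model.ext_fn fun _ _ _ σ _ => by cases σ <;> rfl

theorem Term.eval_map {Sg Sg' : Signature.{u}} (A : Model Sg') (χ : Hom Sg Sg') {s : Sg.Sorts}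
    (t : Term Sg s) : (t.map χ).eval A = t.eval (A.reduct χ) := by
  induction t with
  | app σ ts ih => simp only [Term.map, Term.eval, ih]

theorem Model.act_map {Sg Sg' : Signature.{u}} (A : Model Sg') (χ : Hom Sg Sg')
    (a : Action Sg.Label) (s : Sg.Sorts) :
    A.act (a.map χ.lab) (χ.sort s) = (A.reduct χ).act a s := by
  induction a with
  | lab l => rfl
  | comp a b iha ihb => simp only [Action.map, Model.act, iha, ihb]
  | union a b iha ihb => simp only [Action.map, Model.act, iha, ihb]
  | star a iha => simp only [Action.map, Model.act, iha]

/-- The satisfaction condition: truth is invariant under change of notation. -/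
theorem sat_map {Sg Sg' : Signature.{u}} (χ : Hom Sg Sg') (φ : Sentence Sg) (A : Model Sg') :
    Sat (φ.map χ) A ↔ Sat φ (A.reduct χ) := by
  induction φ generalizing Sg' with
  | eq t u => simp only [Sentence.map, Sat, Term.eval_map]
  | trans t a u => simp only [Sentence.map, Sat, Term.eval_map, Model.act_map]
  | neg φ ih => simp only [Sentence.map, Sat, ih]
  | disj Φ ih => simp only [Sentence.map, Sat, ih]
  | ex X φ ih =>
    simp only [Sentence.map, Sat]
    refine exists_congr fun g => ?_
    rw [ih, Model.reduct_expand]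

/-! ### Countability of the syntax -/

/-- The height of a term. -/
def Term.height {Sg : Signature.{u}} : {s : Sg.Sorts} → Term Sg s → ℕ
  | _, .app _ ts => (Finset.univ.sup fun i => (ts i).height) + 1

/-- The height of an action. -/
def Action.height {L : Type u} : Action L → ℕ
  | .lab _ => 0
  | .comp a b => max a.height b.height + 1
  | .union a b => max a.height b.height + 1
  | .star a => a.height + 1

/-- The height of a sentence; terms and actions do not count. -/
def Sentence.height : {Sg : Signature.{u}} → Sentence Sg → ℕ
  | _, .eq _ _ => 0
  | _, .trans _ _ _ => 0
  | _, .neg φ => φ.height + 1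
  | _, .disj Φ => (Finset.univ.sup fun i => (Φ i).height) + 1
  | _, .ex _ φ => φ.height + 1

theorem countable_of_height {α : Type*} (h : α → ℕ) (H : ∀ n, {x | h x < n}.Countable) :
    Countable α := by
  rw [← Set.countable_univ_iff]
  refine (Set.countable_iUnion H).mono fun x _ => ?_
  exact Set.mem_iUnion.2 ⟨h x + 1, Nat.lt_succ_self _⟩

theorem countable_sigma_term {Sg : Signature.{u}} (hSg : Sg.IsCountable) :
    Countable (Σ s : Sg.Sorts, Term Sg s) := by
  obtain ⟨_, hF, _⟩ := hSg
  refine countable_of_height (fun t => t.2.height) fun n => ?_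
  induction n with
  | zero => simp
  | succ n ih =>
    have (s : Sg.Sorts) : Countable {t : Term Sg s // t.height < n} :=
      (ih.preimage sigma_mk_injective : {t : Term Sg s | t.height < n}.Countable).to_subtype
    -- a term of height at most `n` is determined by its head symbol and its arguments
    refine (Set.countable_range
      fun p : (Σ f : (Σ (n : ℕ) (w : Fin n → Sg.Sorts) (s : Sg.Sorts), Sg.Fn n w s),
          ∀ i, {t : Term Sg (f.2.1 i) // t.height < n}) =>
        (⟨p.1.2.2.1, .app p.1.2.2.2 fun i => (p.2 i).1⟩ : Σ s : Sg.Sorts, Term Sg s)).mono ?_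
    rintro ⟨_, t⟩ h
    cases t with
    | app σ ts =>
      exact ⟨⟨⟨_, _, _, σ⟩, fun i => ⟨ts i,
        lt_of_le_of_lt (Finset.le_sup (f := fun i => (ts i).height) (Finset.mem_univ i))
          (Nat.lt_of_succ_lt_succ h)⟩⟩, rfl⟩

theorem countable_action {L : Type u} [Countable L] : Countable (Action L) := by
  refine countable_of_height Action.height fun n => ?_
  induction n with
  | zero => simp
  | succ n ih =>
    refine ((Set.countable_range Action.lab).union (((ih.prod ih).image
      fun p => Action.comp p.1 p.2).union (((ih.prod ih).image
      fun p => Action.union p.1 p.2).union (ih.image Action.star)))).mono ?_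
    rintro (l | ⟨a, b⟩ | ⟨a, b⟩ | a) h
    all_goals simp_all [Action.height]

instance VarSet.countable {S : Type u} [Countable S] : Countable (VarSet S) := by
  have : Function.Injective
      (fun X : VarSet S => (⟨X.names, X.sort⟩ : Σ N : Finset ℕ, (N → S))) := by
    rintro ⟨N, f⟩ ⟨N', f'⟩ h
    simpa using h
  exact this.countable

theorem Signature.IsCountable.extend {Sg : Signature.{u}} (hSg : Sg.IsCountable)
    (X : VarSet Sg.Sorts) : (Sg.extend X).IsCountable := by
  obtain ⟨hS, hF, hL⟩ := hSg
  refine ⟨hS, ?_, hL⟩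
  let f : ((Σ (n : ℕ) (w : Fin n → Sg.Sorts) (s : Sg.Sorts), Sg.Fn n w s) ⊕ X.names) →
      (Σ (n : ℕ) (w : Fin n → Sg.Sorts) (s : Sg.Sorts), (Sg.extend X).Fn n w s)
    | .inl ⟨n, w, s, σ⟩ => ⟨n, w, s, .old σ⟩
    | .inr x => ⟨0, Fin.elim0, _, .var x Fin.elim0⟩
  refine Function.Surjective.countable (f := f) ?_
  rintro ⟨n, w, s, σ | ⟨x, w⟩⟩
  · exact ⟨.inl ⟨_, _, _, σ⟩, rfl⟩
  · exact ⟨.inr x, by rw [Subsingleton.elim w Fin.elim0]⟩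

theorem countable_sentence {Sg : Signature.{u}} (hSg : Sg.IsCountable) :
    Countable (Sentence Sg) := by
  refine countable_of_height Sentence.height fun n => ?_
  induction n generalizing Sg with
  | zero => simp
  | succ n ih =>
    have := hSg.1
    have := hSg.2.2
    have := countable_sigma_term hSg
    have : ∀ s, Countable (Term Sg s) := fun s =>
      (sigma_mk_injective (i := s) (β := fun s => Term Sg s)).countable
    have := countable_action (L := Sg.Label)
    have := (ih hSg).to_subtype
    have : ∀ X, Countable {φ : Sentence (Sg.extend X) | φ.height < n} :=
      fun X => (ih (hSg.extend X)).to_subtype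
    let B := {φ : Sentence Sg | φ.height < n}
    refine ((Set.countable_range fun p : (Σ s, Term Sg s × Term Sg s) =>
        Sentence.eq p.2.1 p.2.2).union
      ((Set.countable_range fun p : (Σ s, Term Sg s × Action Sg.Label × Term Sg s) =>
        Sentence.trans p.2.1 p.2.2.1 p.2.2.2).union
      (((ih hSg).image Sentence.neg).union
      ((Set.countable_range fun p : (Σ k, (Fin k → B)) =>
        Sentence.disj fun i => (p.2 i).1).union
      (Set.countable_range fun p :
        (Σ X, {φ : Sentence (Sg.extend X) | φ.height < n}) => Sentence.ex p.1 p.2.1))))).mono ?_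
    intro φ h
    cases φ with
    | eq t u => exact .inl ⟨⟨_, t, u⟩, rfl⟩
    | trans t a u => exact .inr (.inl ⟨⟨_, t, a, u⟩, rfl⟩)
    | neg φ => exact .inr (.inr (.inl ⟨φ, Nat.lt_of_succ_lt_succ h, rfl⟩))
    | disj Φ =>
      exact .inr (.inr (.inr (.inl ⟨⟨_, fun i => ⟨Φ i,
        lt_of_le_of_lt (Finset.le_sup (f := fun i => (Φ i).height) (Finset.mem_univ i))
          (Nat.lt_of_succ_lt_succ h)⟩⟩, rfl⟩)))
    | ex X φ => exact .inr (.inr (.inr (.inr ⟨⟨X, φ, Nat.lt_of_succ_lt_succ h⟩, rfl⟩)))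

/-! ### Derived rules of entailment -/

theorem Entails.weaken {Sg : Signature.{u}} {Γ Γ' Φ : Set (Sentence Sg)} (h : Γ ⊆ Γ')
    (hΓ : Entails Sg Γ Φ) : Entails Sg Γ' Φ :=
  .transitivity (.monotonicity h) hΓ

theorem Entails.of_mem {Sg : Signature.{u}} {Γ : Set (Sentence Sg)} {φ : Sentence Sg}
    (h : φ ∈ Γ) : Entails Sg Γ {φ} :=
  .monotonicity (Set.singleton_subset_iff.2 h)

theorem Entails.cut {Sg : Signature.{u}} {Γ Δ Φ : Set (Sentence Sg)}
    (h : ∀ δ ∈ Δ, Entails Sg Γ {δ}) (hΦ : Entails Sg (Γ ∪ Δ) Φ) : Entails Sg Γ Φ :=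
  .transitivity (.union fun _ hφ => hφ.elim Entails.of_mem (h _)) hΦ

theorem Entails.cut_singleton {Sg : Signature.{u}} {Γ Φ : Set (Sentence Sg)} {δ : Sentence Sg}
    (h : Entails Sg Γ {δ}) (hΦ : Entails Sg (Γ ∪ {δ}) Φ) : Entails Sg Γ Φ :=
  .cut (by simpa using h) hΦ

theorem Entails.map {Sg Sg' : Signature.{u}} (χ : Hom Sg Sg') {Γ : Set (Sentence Sg)}
    {Γ' : Set (Sentence Sg')} {φ : Sentence Sg} (hΓ : ∀ γ ∈ Γ, γ.map χ ∈ Γ')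
    (h : Entails Sg Γ {φ}) : Entails Sg' Γ' {φ.map χ} := by
  have := Entails.translation χ h
  rw [Set.image_singleton] at this
  exact this.weaken (Set.image_subset_iff.2 hΓ)

/-- Consistency is preserved by translation along a morphism with a retraction. Without the
retraction this fails: a new constant may inhabit a sort that is provably empty. -/
theorem Consistent.image {Sg Sg' : Signature.{u}} {χ : Hom Sg Sg'} {κ : Hom Sg' Sg}
    (hκ : κ.comp χ = Hom.id Sg) {Γ : Set (Sentence Sg)} (hΓ : Consistent Γ) :
    Consistent ((fun φ => φ.map χ) '' Γ) := by
  intro h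
  refine hΓ ?_
  have := Entails.map κ (Γ' := Γ) ?_ h
  · rwa [Sentence.map_bot] at this
  · rintro _ ⟨φ, hφ, rfl⟩
    rwa [Sentence.map_comp, hκ, Sentence.map_id]

theorem Term.subst_lift {Sg : Signature.{u}} {X : VarSet Sg.Sorts}
    (θ : ∀ x : X.names, Term Sg (X.sort x)) {s : Sg.Sorts} (t : Term Sg s) :
    (t.map (Hom.incl Sg X)).subst (Subst.ofTerms θ) = t := by
  induction t with
  | app σ ts ih =>
    simp only [Term.map, Term.subst, Op.app]
    congr 1
    funext i
    exact ih i

/-- Every term has a value: `∃ x · t = x` is derivable. -/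
theorem Entails.exists_eq {Sg : Signature.{u}} (Γ : Set (Sentence Sg)) {s : Sg.Sorts}
    (t : Term Sg s) :
    Entails Sg Γ {.ex (VarSet.single 0 s) (.eq (t.map (Hom.incl Sg (VarSet.single 0 s)))
      (Term.var (Sg := Sg) (X := VarSet.single 0 s) ⟨0, Finset.mem_singleton_self 0⟩))} := by
  refine .subst (fun _ => t) ?_
  simp only [Sentence.subst]
  rw [Term.subst_lift]
  exact .refl t

/-! ### Adding constants to a signature -/

/-- The function symbols of `Σ` and, for each `(s, i) ∈ X`, a new constant of sort `s` with
name `i`. -/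
inductive ConstFn {S : Type u} (F : (n : ℕ) → (Fin n → S) → S → Type u) (X : Finset (S × ℕ)) :
    (n : ℕ) → (Fin n → S) → S → Type u
  | old {n : ℕ} {w : Fin n → S} {s : S} (σ : F n w s) : ConstFn F X n w s
  | const {s : S} (i : ℕ) (h : (s, i) ∈ X) (w : Fin 0 → S) : ConstFn F X 0 w s

/-- `Σ` with the elements of `X` as new constants. In contrast to `Σ[X]`, these extensions are
ordered by inclusion, so that iterated extensions do not get nested. -/
abbrev Signature.withConsts (Sg : Signature.{u}) (X : Finset (Sg.Sorts × ℕ)) :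
    Signature.{u} where
  Sorts := Sg.Sorts
  Fn := ConstFn Sg.Fn X
  Mono := {τ | ∃ σ ∈ Sg.Mono, τ = .old σ}
  Label := Sg.Label

variable {Sg : Signature.{u}} {X Z : Finset (Sg.Sorts × ℕ)}

/-- The new constant `i` of sort `s`, as a term. -/
abbrev Term.const {s : Sg.Sorts} (i : ℕ) (h : (s, i) ∈ X) : Term (Sg.withConsts X) s :=
  .app (Sg := Sg.withConsts X) (ConstFn.const i h Fin.elim0) fun k => k.elim0

/-- The inclusion of `Σ` into its extension by constants. -/
abbrev Hom.toConsts (Sg : Signature.{u}) (X : Finset (Sg.Sorts × ℕ)) :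
    Hom Sg (Sg.withConsts X) where
  sort := fun s => s
  fn := fun σ => ConstFn.old σ
  mono := fun σ hσ => ⟨σ, hσ, rfl⟩
  lab := fun l => l

/-- The inclusion between extensions by constants. -/
abbrev Hom.inclConsts (h : X ⊆ Z) : Hom (Sg.withConsts X) (Sg.withConsts Z) where
  sort := fun s => s
  fn := fun τ => match τ with
    | ConstFn.old σ => ConstFn.old σ
    | ConstFn.const i hi w => ConstFn.const i (h hi) w
  mono := by
    rintro n w s _ ⟨σ, hσ, rfl⟩
    exact ⟨σ, hσ, rfl⟩
  lab := fun l => l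

/-- The morphism that instantiates the variables of `Y` by constants; `e y` is the name of the
constant for `y`. -/
abbrev Hom.instantiate (h : X ⊆ Z) {Y : VarSet Sg.Sorts} (e : Y.names → ℕ)
    (he : ∀ y, (Y.sort y, e y) ∈ Z) :
    Hom ((Sg.withConsts X).extend Y) (Sg.withConsts Z) where
  sort := fun s => s
  fn := fun τ => match τ with
    | ExtFn.old (ConstFn.old σ) => ConstFn.old σ
    | ExtFn.old (ConstFn.const i hi w) => ConstFn.const i (h hi) w
    | ExtFn.var y w => ConstFn.const (e y) (he y) w
  mono := by
    rintro n w s _ ⟨_, ⟨σ, hσ, rfl⟩, rfl⟩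
    exact ⟨σ, hσ, rfl⟩
  lab := fun l => l

theorem Hom.inclConsts_refl : Hom.inclConsts (Finset.Subset.refl X) = Hom.id _ :=
  Hom.ext_fn fun _ _ _ σ => by cases σ <;> rfl

theorem Hom.inclConsts_comp {W : Finset (Sg.Sorts × ℕ)} (h : X ⊆ Z) (h' : Z ⊆ W) :
    (Hom.inclConsts h').comp (Hom.inclConsts h) = Hom.inclConsts (h.trans h') :=
  Hom.ext_fn fun _ _ _ σ => by cases σ <;> rfl

theorem Hom.instantiate_comp_incl (h : X ⊆ Z) {Y : VarSet Sg.Sorts} (e : Y.names → ℕ)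
    (he : ∀ y, (Y.sort y, e y) ∈ Z) :
    (Hom.instantiate h e he).comp (Hom.incl (Sg.withConsts X) Y) = Hom.inclConsts h :=
  Hom.ext_fn fun _ _ _ σ => by cases σ <;> rfl

theorem Hom.inclConsts_comp_instantiate {W : Finset (Sg.Sorts × ℕ)} (h : X ⊆ Z) (h' : Z ⊆ W)
    {Y : VarSet Sg.Sorts} (e : Y.names → ℕ) (he : ∀ y, (Y.sort y, e y) ∈ Z) :
    (Hom.inclConsts h').comp (Hom.instantiate h e he) =
      Hom.instantiate (h.trans h') e fun y => h' (he y) :=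
  Hom.ext_fn fun _ _ _ σ => by rcases σ with (_ | _) | _ <;> rfl

theorem Hom.instantiate_comp_extend {W : Finset (Sg.Sorts × ℕ)} (h : X ⊆ Z) (h' : Z ⊆ W)
    {Y : VarSet Sg.Sorts} (e : Y.names → ℕ) (he : ∀ y, (Y.sort y, e y) ∈ W) :
    (Hom.instantiate h' e he).comp ((Hom.inclConsts h).extend Y) =
      Hom.instantiate (h.trans h') e he :=
  Hom.ext_fn fun _ _ _ σ => by rcases σ with (_ | _) | _ <;> rfl

/-- The equation `Hom.ext_fn` applied to terms. It is stated separately because the type of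
`t.map χ` depends on `χ`, so that equations between morphisms cannot be rewritten in it. -/
theorem Term.map_congr {Sg Sg' : Signature.{u}} {f : Sg.Sorts → Sg'.Sorts}
    {g : Sg.Label → Sg'.Label}
    {F F' : {n : ℕ} → {w : Fin n → Sg.Sorts} → {s : Sg.Sorts} →
      Sg.Fn n w s → Sg'.Fn n (fun i => f (w i)) (f s)} {m m'}
    (h : ∀ (n : ℕ) (w : Fin n → Sg.Sorts) (s : Sg.Sorts) (σ : Sg.Fn n w s), F σ = F' σ)
    {s : Sg.Sorts} (t : Term Sg s) :
    t.map (⟨f, F, m, g⟩ : Hom Sg Sg') = t.map ⟨f, F', m', g⟩ := by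
  have : @F = @F' := by
    funext n w s σ
    exact h n w s σ
  subst this
  rfl

theorem Term.map_inclConsts_comp {W : Finset (Sg.Sorts × ℕ)} (h : X ⊆ Z) (h' : Z ⊆ W)
    {s : Sg.Sorts} (t : Term (Sg.withConsts X) s) :
    (t.map (Hom.inclConsts h)).map (Hom.inclConsts h') = t.map (Hom.inclConsts (h.trans h')) := by
  rw [Term.map_comp]
  exact Term.map_congr (fun _ _ _ σ => by cases σ <;> rfl) t

theorem Term.map_incl_instantiate (h : X ⊆ Z) {Y : VarSet Sg.Sorts} (e : Y.names → ℕ)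
    (he : ∀ y, (Y.sort y, e y) ∈ Z) {s : Sg.Sorts} (t : Term (Sg.withConsts X) s) :
    (t.map (Hom.incl (Sg.withConsts X) Y)).map (Hom.instantiate h e he) =
      t.map (Hom.inclConsts h) := by
  rw [Term.map_comp]
  exact Term.map_congr (fun _ _ _ σ => by cases σ <;> rfl) t

theorem Term.map_const (h : X ⊆ Z) {s : Sg.Sorts} (i : ℕ) (hi : (s, i) ∈ X) :
    (Term.const i hi).map (Hom.inclConsts h) = Term.const i (h hi) := by
  simp only [Term.map]
  congr 1
  funext k
  exact k.elim0

theorem Term.map_var_instantiate (h : X ⊆ Z) {Y : VarSet Sg.Sorts} (e : Y.names → ℕ)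
    (he : ∀ y, (Y.sort y, e y) ∈ Z) (y : Y.names) :
    (Term.var (Sg := Sg.withConsts X) (X := Y) y).map (Hom.instantiate h e he) =
      Term.const (e y) (he y) := by
  simp only [Term.map, Term.var]
  congr 1
  funext k
  exact k.elim0

open Classical in
/-- The constants `(s, N + k)` for the variables of sort `s` and name `v_k` in `Y`. -/
noncomputable def freshConsts (Y : VarSet Sg.Sorts) (N : ℕ) : Finset (Sg.Sorts × ℕ) :=
  Finset.univ.image fun y : Y.names => (Y.sort y, N + y)

open Classical in
/-- Replacing fresh constants by variables: a retraction of the instantiation of the variables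
of `Y` by constants that are not in `X`. -/
noncomputable abbrev Hom.generalize (X : Finset (Sg.Sorts × ℕ)) (Y : VarSet Sg.Sorts) (N : ℕ) :
    Hom (Sg.withConsts (X ∪ freshConsts Y N)) ((Sg.withConsts X).extend Y) where
  sort := fun s => s
  fn := fun τ => match τ with
    | ConstFn.old σ => ExtFn.old (ConstFn.old σ)
    | ConstFn.const (s := s) i hi w =>
      if hX : (s, i) ∈ X then ExtFn.old (ConstFn.const i hX w)
      else
        have hy : ∃ y : Y.names, (Y.sort y, N + (y : ℕ)) = (s, i) := by
          simpa [freshConsts, hX] using hi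
        have hs : Y.sort hy.choose = s := congrArg Prod.fst hy.choose_spec
        hs ▸ ExtFn.var (F := ConstFn Sg.Fn X) (X := Y) hy.choose w
  mono := by
    rintro n w s _ ⟨σ, hσ, rfl⟩
    exact ⟨_, ⟨σ, hσ, rfl⟩, rfl⟩
  lab := fun l => l

open Classical in
theorem Hom.generalize_comp_instantiate {N : ℕ} (hN : ∀ c ∈ X, c.2 < N) (Y : VarSet Sg.Sorts) :
    (Hom.generalize X Y N).comp
      (Hom.instantiate (Z := X ∪ freshConsts Y N) Finset.subset_union_left (fun y => N + y)
        (fun y => Finset.mem_union_right _ (Finset.mem_image_of_mem _ (Finset.mem_univ y)))) =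
      Hom.id _ := by
  refine Hom.ext_fn fun n w s σ => ?_
  rcases σ with (σ | ⟨i, hi, w⟩) | ⟨y, w⟩
  · rfl
  · simp [hi]
  · have hX : (Y.sort y, N + (y : ℕ)) ∉ X := fun h => by
      have := hN _ h
      simp at this
    have key : ∀ (y' : Y.names) (h : Y.sort y' = Y.sort y), y' = y →
        (h ▸ ExtFn.var (F := ConstFn Sg.Fn X) (X := Y) y' w :
          ExtFn (ConstFn Sg.Fn X) Y 0 w (Y.sort y)) = ExtFn.var y w := by
      rintro _ _ rfl
      rfl
    have hy : ∃ y' : Y.names, (Y.sort y', N + (y' : ℕ)) = (Y.sort y, N + (y : ℕ)) := ⟨y, rfl⟩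
    have := hy.choose_spec
    simp only [hX, dite_false]
    refine key _ _ (Subtype.ext ?_)
    simpa using congrArg Prod.snd this

/-- Introduction of the existential quantifier for witnesses that are constants: `∃ Y · ψ` entails
itself, so by elimination `ψ` entails it over the signature with the variables `Y`, and the
instantiation of these variables is a signature morphism. Substitutions are not needed. -/
theorem Entails.ex_of_instantiate {Γ : Set (Sentence (Sg.withConsts X))} {Y : VarSet Sg.Sorts}
    {ψ : Sentence ((Sg.withConsts X).extend Y)} (e : Y.names → ℕ)
    (he : ∀ y, (Y.sort y, e y) ∈ X)
    (h : Entails _ Γ {ψ.map (Hom.instantiate (Finset.Subset.refl X) e he)}) :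
    Entails (Sg.withConsts X) Γ {.ex Y ψ} := by
  have h₁ : Entails (Sg.withConsts X) (Γ ∪ {.ex Y ψ}) {.ex Y ψ} := .of_mem (by simp)
  have key (φ : Sentence (Sg.withConsts X)) :
      (Sentence.lift (Sg := Sg.withConsts X) Y φ).map
        (Hom.instantiate (Finset.Subset.refl X) e he) = φ := by
    rw [Sentence.lift, Sentence.map_comp, Hom.instantiate_comp_incl, Hom.inclConsts_refl,
      Sentence.map_id]
  have h₂ := (Entails.quant_elim h₁).map (Hom.instantiate (Finset.Subset.refl X) e he)
    (Γ' := Γ ∪ {ψ.map (Hom.instantiate (Finset.Subset.refl X) e he)}) (by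
      rintro _ (⟨γ, hγ, rfl⟩ | rfl)
      · rw [key]
        exact .inl hγ
      · exact .inr rfl)
  rw [key] at h₂
  exact .cut_singleton h h₂

/-! ### Forcing conditions -/

/-- A forcing condition: a consistent set of sentences in finitely many new constants. -/
structure Condition (Sg : Signature.{u}) where
  names : Finset (Sg.Sorts × ℕ)
  theory : Set (Sentence (Sg.withConsts names))
  consistent : Consistent theory

/-- A condition becomes stronger by knowing more constants and more sentences. -/
instance : Preorder (Condition Sg) where
  le p q := ∃ h : p.names ⊆ q.names, ∀ φ ∈ p.theory, φ.map (Hom.inclConsts h) ∈ q.theory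
  le_refl p := ⟨Finset.Subset.refl _, fun φ hφ => by
    rwa [Hom.inclConsts_refl, Sentence.map_id]⟩
  le_trans p q r := by
    rintro ⟨h, hpq⟩ ⟨h', hqr⟩
    refine ⟨h.trans h', fun φ hφ => ?_⟩
    have := hqr _ (hpq φ hφ)
    rwa [Sentence.map_comp, Hom.inclConsts_comp] at this

/-- `p ⊩ φ`: the constants in `φ` are known to `p`, and the theory of `p` entails `φ`. -/
def Condition.Forces (p : Condition Sg) (φ : Sentence (Sg.withConsts X)) : Prop :=
  ∃ h : X ⊆ p.names, Entails _ p.theory {φ.map (Hom.inclConsts h)}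

theorem Condition.entails_map {p q : Condition Sg} (h : p.names ⊆ q.names)
    (hpq : p ≤ q) {φ : Sentence (Sg.withConsts p.names)} (hφ : Entails _ p.theory {φ}) :
    Entails _ q.theory {φ.map (Hom.inclConsts h)} :=
  hφ.map _ hpq.2

theorem Condition.Forces.mono {p q : Condition Sg} (hpq : p ≤ q)
    {φ : Sentence (Sg.withConsts X)} (hφ : p.Forces φ) : q.Forces φ := by
  obtain ⟨h, hφ⟩ := hφ
  refine ⟨h.trans hpq.1, ?_⟩
  have := Condition.entails_map hpq.1 hpq hφ
  rwa [Sentence.map_comp, Hom.inclConsts_comp] at this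

theorem Condition.forces_map {p : Condition Sg} (h : X ⊆ Z) (hZ : Z ⊆ p.names)
    {φ : Sentence (Sg.withConsts X)} : p.Forces (φ.map (Hom.inclConsts h)) ↔ p.Forces φ := by
  constructor
  · rintro ⟨h', hφ⟩
    rw [Sentence.map_comp, Hom.inclConsts_comp] at hφ
    exact ⟨_, hφ⟩
  · rintro ⟨h', hφ⟩
    refine ⟨hZ, ?_⟩
    rwa [Sentence.map_comp, Hom.inclConsts_comp]

/-- A sentence that is consistent with a condition is forced by an extension of it. -/
theorem Condition.exists_insert (p : Condition Sg) {φ : Sentence (Sg.withConsts p.names)}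
    (h : ¬ Entails _ (p.theory ∪ {φ}) {Sentence.bot _}) :
    ∃ q : Condition Sg, ∃ hpq : p ≤ q,
      Entails _ q.theory {φ.map (Hom.inclConsts hpq.1)} := by
  refine ⟨⟨p.names, p.theory ∪ {φ}, h⟩, ⟨Finset.Subset.refl _, fun ψ hψ => .inl ?_⟩, ?_⟩
  · rwa [Hom.inclConsts_refl, Sentence.map_id]
  · rw [Hom.inclConsts_refl, Sentence.map_id]
    exact .of_mem (.inr rfl)

/-- Variables can be named by fresh constants: a consistent extension of a condition in finitely
many variables is an extension in constants. -/
theorem Condition.exists_instantiate (p : Condition Sg) (Y : VarSet Sg.Sorts)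
    (Δ : Set (Sentence ((Sg.withConsts p.names).extend Y)))
    (hΔ : Consistent (Sentence.lift (Sg := Sg.withConsts p.names) Y '' p.theory ∪ Δ)) :
    ∃ q : Condition Sg, ∃ hpq : p ≤ q, ∃ e : Y.names → ℕ,
      ∃ he : ∀ y, (Y.sort y, e y) ∈ q.names,
        ∀ φ ∈ Δ, Entails _ q.theory {φ.map (Hom.instantiate hpq.1 e he)} := by
  classical
  obtain ⟨N, hN⟩ : ∃ N, ∀ c ∈ p.names, c.2 < N :=
    ⟨p.names.sup Prod.snd + 1, fun c hc => Nat.lt_succ_of_le (Finset.le_sup (f := Prod.snd) hc)⟩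
  -- the names of the new constants start at a strict bound `N` of the names that `p` knows
  refine ⟨⟨_, _, hΔ.image (Hom.generalize_comp_instantiate hN Y)⟩, ⟨Finset.subset_union_left,
    fun φ hφ => ?_⟩, _, _, fun φ hφ => .of_mem (Set.mem_image_of_mem _ (.inr hφ))⟩
  refine ⟨Sentence.lift (Sg := Sg.withConsts p.names) Y φ, .inl ⟨φ, hφ, rfl⟩, ?_⟩
  simp only [Sentence.lift, Sentence.map_comp]
  rw [Hom.instantiate_comp_incl]

/-- A sentence is witnessed in a theory if the theory entails an instance from which the sentence
follows by the introduction rule for its outermost connective; a sentence without such a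
connective, or a negation, is witnessed if it is entailed. -/
def Witnessed (Γ : Set (Sentence (Sg.withConsts X))) : Sentence (Sg.withConsts X) → Prop
  | .trans (s := s) t (.comp a b) u => ∃ v : Term (Sg.withConsts X) s,
      Entails _ Γ {.trans t a v} ∧ Entails _ Γ {.trans v b u}
  | .trans t (.union a b) u => Entails _ Γ {.trans t a u} ∨ Entails _ Γ {.trans t b u}
  | .trans t (.star a) u => ∃ n, Entails _ Γ {.transPow t a u n}
  | .disj Φ => ∃ i, Entails _ Γ {Φ i}
  | .ex Y ψ => ∃ (e : Y.names → ℕ) (he : ∀ y, (Y.sort y, e y) ∈ X),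
      Entails _ Γ {ψ.map (Hom.instantiate (Finset.Subset.refl X) e he)}
  | φ => Entails _ Γ {φ}

theorem Witnessed.entails {Γ : Set (Sentence (Sg.withConsts X))}
    {φ : Sentence (Sg.withConsts X)} (h : Witnessed Γ φ) : Entails _ Γ {φ} := by
  cases φ with
  | eq t u => exact h
  | neg φ => exact h
  | trans t a u =>
    cases a with
    | lab l => exact h
    | comp a b => exact .comp_intro h.choose_spec.1 h.choose_spec.2
    | union a b => exact h.elim .union_intro_left .union_intro_right
    | star a => exact .star_intro _ h.choose_spec
  | disj Φ => exact .disj_intro _ h.choose_spec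
  | ex Y ψ => exact .ex_of_instantiate _ _ h.choose_spec.choose_spec

/-- Every sentence entailed by a condition is witnessed in an extension: if all witnesses were
inconsistent with the condition, so would be the sentence, by the elimination rule for its
outermost connective. For `a*` this rule has infinitely many premises, one for each power. -/
theorem Condition.exists_witnessed (p : Condition Sg) {φ : Sentence (Sg.withConsts p.names)}
    (h : Entails _ p.theory {φ}) :
    ∃ q : Condition Sg, ∃ hpq : p ≤ q, Witnessed q.theory (φ.map (Hom.inclConsts hpq.1)) := by
  have hp : ∃ q : Condition Sg, ∃ hpq : p ≤ q,
      Entails _ q.theory {φ.map (Hom.inclConsts hpq.1)} :=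
    ⟨p, le_rfl, by rwa [Hom.inclConsts_refl, Sentence.map_id]⟩
  cases φ with
  | eq t u => exact hp
  | neg φ => exact hp
  | trans t a u =>
    cases a with
    | lab l => exact hp
    | comp a b =>
      rename_i s
      by_cases hc : Consistent
          (Sentence.lift (Sg := Sg.withConsts p.names) (VarSet.single 0 s) '' p.theory ∪
          {Sentence.trans (Sg := (Sg.withConsts p.names).extend (VarSet.single 0 s))
              (t.map (Hom.incl (Sg.withConsts p.names) (VarSet.single 0 s))) a
              (Term.var (Sg := Sg.withConsts p.names) (X := VarSet.single 0 s)
                ⟨0, Finset.mem_singleton_self 0⟩),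
            Sentence.trans (Sg := (Sg.withConsts p.names).extend (VarSet.single 0 s))
              (Term.var (Sg := Sg.withConsts p.names) (X := VarSet.single 0 s)
                ⟨0, Finset.mem_singleton_self 0⟩)
              b (u.map (Hom.incl (Sg.withConsts p.names) (VarSet.single 0 s)))})
      · obtain ⟨q, hpq, e, he, H⟩ := p.exists_instantiate _ _ hc
        refine ⟨q, hpq, Term.map (Hom.instantiate hpq.1 e he)
          (Term.var (Sg := Sg.withConsts p.names) (X := VarSet.single 0 s)
                ⟨0, Finset.mem_singleton_self 0⟩), ?_, ?_⟩
        · have := H _ (.inl rfl)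
          simp only [Sentence.map] at this
          rwa [Term.map_incl_instantiate] at this
        · have := H _ (.inr rfl)
          simp only [Sentence.map] at this
          rwa [Term.map_incl_instantiate] at this
      · refine (p.consistent (.comp_elim 0 h ?_)).elim
        rw [Sentence.lift, Sentence.map_bot]
        exact not_not.1 hc
    | union a b =>
      by_contra hq
      refine p.consistent (.union_elim h ?_ ?_)
      · by_contra hc
        obtain ⟨q, hpq, H⟩ := p.exists_insert hc
        exact hq ⟨q, hpq, .inl H⟩
      · by_contra hc
        obtain ⟨q, hpq, H⟩ := p.exists_insert hc
        exact hq ⟨q, hpq, .inr H⟩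
    | star a =>
      by_contra hq
      refine p.consistent (.star_elim h fun n => ?_)
      by_contra hc
      obtain ⟨q, hpq, H⟩ := p.exists_insert hc
      rw [Sentence.map_transPow] at H
      exact hq ⟨q, hpq, n, H⟩
  | disj Φ =>
    by_contra hq
    refine p.consistent (.disj_elim h fun i => ?_)
    by_contra hc
    obtain ⟨q, hpq, H⟩ := p.exists_insert hc
    exact hq ⟨q, hpq, i, H⟩
  | ex Y ψ =>
    by_cases hc : Consistent (Sentence.lift (Sg := Sg.withConsts p.names) Y '' p.theory ∪ {ψ})
    · obtain ⟨q, hpq, e, he, H⟩ := p.exists_instantiate _ _ hc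
      refine ⟨q, hpq, e, he, ?_⟩
      have := H _ rfl
      rwa [Sentence.map_comp, Hom.instantiate_comp_extend]
    · refine (p.consistent (.cut_singleton h (.quant_intro ?_))).elim
      rw [Sentence.lift, Sentence.map_bot]
      exact not_not.1 hc

/-- `p` realizes `φ` if `φ` is witnessed in the theory of `p`. -/
def Condition.Realizes (p : Condition Sg) (φ : Sentence (Sg.withConsts X)) : Prop :=
  ∃ h : X ⊆ p.names, Witnessed p.theory (φ.map (Hom.inclConsts h))

theorem Condition.Realizes.forces {p : Condition Sg} {φ : Sentence (Sg.withConsts X)}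
    (h : p.Realizes φ) : p.Forces φ :=
  ⟨h.1, h.2.entails⟩

theorem Condition.Forces.exists_realizes {p : Condition Sg} {φ : Sentence (Sg.withConsts X)}
    (h : p.Forces φ) : ∃ q, p ≤ q ∧ q.Realizes φ := by
  obtain ⟨h, hφ⟩ := h
  obtain ⟨q, hpq, H⟩ := p.exists_witnessed hφ
  rw [Sentence.map_comp, Hom.inclConsts_comp] at H
  exact ⟨q, hpq, _, H⟩

/-! ### Generic ideals -/

/-- An ideal of conditions is generic if for every sentence it either realizes the sentence or
excludes this for all extensions of one of its members. -/
def IsGeneric (G : Order.Ideal (Condition Sg)) : Prop :=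
  ∀ (X : Finset (Sg.Sorts × ℕ)) (φ : Sentence (Sg.withConsts X)),
    ∃ p ∈ G, p.Realizes φ ∨ ∀ q, p ≤ q → ¬ q.Realizes φ

theorem Signature.IsCountable.withConsts (hSg : Sg.IsCountable) (X : Finset (Sg.Sorts × ℕ)) :
    (Sg.withConsts X).IsCountable := by
  obtain ⟨hS, hF, hL⟩ := hSg
  refine ⟨hS, ?_, hL⟩
  let f : ((Σ (n : ℕ) (w : Fin n → Sg.Sorts) (s : Sg.Sorts), Sg.Fn n w s) ⊕ X) →
      (Σ (n : ℕ) (w : Fin n → Sg.Sorts) (s : Sg.Sorts), (Sg.withConsts X).Fn n w s)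
    | .inl ⟨n, w, s, σ⟩ => ⟨n, w, s, .old σ⟩
    | .inr c => ⟨0, Fin.elim0, _, .const c.1.2 c.2 Fin.elim0⟩
  refine Function.Surjective.countable (f := f) ?_
  rintro ⟨n, w, s, σ | ⟨i, h, w⟩⟩
  · exact ⟨.inl ⟨_, _, _, σ⟩, rfl⟩
  · exact ⟨.inr ⟨(s, i), h⟩, by rw [Subsingleton.elim w Fin.elim0]⟩

/-- The Rasiowa–Sikorski lemma for conditions over a countable signature. -/
theorem exists_isGeneric (hSg : Sg.IsCountable) (p : Condition Sg) :
    ∃ G : Order.Ideal (Condition Sg), p ∈ G ∧ IsGeneric G := by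
  have := hSg.1
  have : ∀ X, Countable (Sentence (Sg.withConsts X)) :=
    fun X => countable_sentence (hSg.withConsts X)
  let ι := Σ X : Finset (Sg.Sorts × ℕ), Sentence (Sg.withConsts X)
  have : Encodable ι := Encodable.ofCountable ι
  let D : ι → Order.Cofinal (Condition Sg) := fun i =>
    { carrier := {p | p.Realizes i.2 ∨ ∀ q, p ≤ q → ¬ q.Realizes i.2}
      isCofinal := fun p => by
        by_cases h : ∃ q, p ≤ q ∧ q.Realizes i.2
        · obtain ⟨q, hpq, hq⟩ := h
          exact ⟨q, .inl hq, hpq⟩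
        · exact ⟨p, .inr fun q hpq hq => h ⟨q, hpq, hq⟩, le_rfl⟩ }
  refine ⟨Order.idealOfCofinals p D, Order.mem_idealOfCofinals p D, fun X φ => ?_⟩
  obtain ⟨q, hq, hG⟩ := Order.cofinal_meets_idealOfCofinals p D ⟨X, φ⟩
  exact ⟨q, hG, hq⟩

variable {G : Order.Ideal (Condition Sg)}

/-- The constants in `X` are known to the ideal `G`. -/
def Live (G : Order.Ideal (Condition Sg)) (X : Finset (Sg.Sorts × ℕ)) : Prop :=
  ∃ p ∈ G, X ⊆ p.names

/-- The sentence `φ` is forced by a member of `G`. -/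
def Forced (G : Order.Ideal (Condition Sg)) (φ : Sentence (Sg.withConsts X)) : Prop :=
  ∃ p ∈ G, p.Forces φ

/-- Finitely many members of an ideal have a common extension in it. -/
theorem exists_upper_bound {ι : Type*} [Finite ι] (p : ι → Condition Sg) (hp : ∀ i, p i ∈ G) :
    ∃ q ∈ G, ∀ i, p i ≤ q := by
  have : Nonempty G := G.nonempty.to_subtype
  obtain ⟨q, hq⟩ := (directedOn_iff_directed.1 G.directed).finite_le (fun i => ⟨p i, hp i⟩)
  exact ⟨q.1, q.2, hq⟩

theorem Live.exists_common (hX : Live G X) (hZ : Live G Z) :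
    ∃ W, Live G W ∧ X ⊆ W ∧ Z ⊆ W := by
  obtain ⟨p, hp, hX⟩ := hX
  obtain ⟨q, hq, hZ⟩ := hZ
  obtain ⟨r, hr, hpr, hqr⟩ := G.directed p hp q hq
  exact ⟨r.names, ⟨r, hr, Finset.Subset.refl _⟩, hX.trans hpr.1, hZ.trans hqr.1⟩

/-- Finitely many forced sentences are entailed by a single member of `G`. -/
theorem Forced.exists_entails (hX : Live G X) {ι : Type*} [Finite ι]
    {φ : ι → Sentence (Sg.withConsts X)} (hφ : ∀ i, Forced G (φ i)) :
    ∃ p ∈ G, ∃ h : X ⊆ p.names, ∀ i, Entails _ p.theory {(φ i).map (Hom.inclConsts h)} := by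
  obtain ⟨p, hp, hXp⟩ := hX
  choose q hq hqφ using hφ
  obtain ⟨r, hr, hqr⟩ := exists_upper_bound q hq
  obtain ⟨r', hr', hpr, hrr⟩ := G.directed p hp r hr
  exact ⟨r', hr', hXp.trans hpr.1, fun i => ((hqφ i).mono ((hqr i).trans hrr)).2⟩

theorem forced_map (h : X ⊆ Z) (hZ : Live G Z) {φ : Sentence (Sg.withConsts X)} :
    Forced G (φ.map (Hom.inclConsts h)) ↔ Forced G φ := by
  constructor
  · rintro ⟨p, hp, hφ⟩
    exact ⟨p, hp, (Condition.forces_map h hφ.1).1 hφ⟩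
  · rintro ⟨p, hp, hφ⟩
    obtain ⟨q, hq, hZq⟩ := hZ
    obtain ⟨r, hr, hpr, hqr⟩ := G.directed p hp q hq
    exact ⟨r, hr, (Condition.forces_map h (hZq.trans hqr.1)).2 (hφ.mono hpr)⟩

theorem Forced.exists_realizes (hG : IsGeneric G) {φ : Sentence (Sg.withConsts X)}
    (h : Forced G φ) : ∃ p ∈ G, p.Realizes φ := by
  obtain ⟨p, hp, hφ⟩ := h
  obtain ⟨q, hq, hq' | hq'⟩ := hG X φ
  · exact ⟨q, hq, hq'⟩
  · obtain ⟨r, -, hpr, hqr⟩ := G.directed p hp q hq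
    obtain ⟨r', hrr, hr'⟩ := (hφ.mono hpr).exists_realizes
    exact (hq' r' (hqr.trans hrr) hr').elim

/-- If no condition in `G` forces `φ`, then some condition in `G` has no extension forcing `φ`, so
its theory refutes `φ`. -/
theorem forced_neg (hG : IsGeneric G) (hX : Live G X) {φ : Sentence (Sg.withConsts X)} :
    Forced G φ.neg ↔ ¬ Forced G φ := by
  constructor
  · intro hn hφ
    obtain ⟨p, -, h, H⟩ := Forced.exists_entails hX (φ := fun b : Bool => cond b φ φ.neg)
      (by rintro (_ | _) <;> assumption)
    exact p.consistent (.cut_singleton (H true) (.neg_elim (H false)))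
  · intro hφ
    obtain ⟨p, hp, hp' | hp'⟩ := hG X φ
    · exact (hφ ⟨p, hp, hp'.forces⟩).elim
    obtain ⟨q, hq, hXq⟩ := hX
    obtain ⟨r, hr, hpr, hqr⟩ := G.directed p hp q hq
    refine ⟨r, hr, hXq.trans hqr.1, .neg_intro ?_⟩
    by_contra hc
    obtain ⟨r', hrr, H⟩ := r.exists_insert hc
    rw [Sentence.map_comp, Hom.inclConsts_comp] at H
    obtain ⟨r'', hrr', H'⟩ := Condition.Forces.exists_realizes ⟨_, H⟩
    exact hp' r'' (hpr.trans (hrr.trans hrr')) H'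

theorem forced_disj (hG : IsGeneric G) {n : ℕ} {Φ : Fin n → Sentence (Sg.withConsts X)} :
    Forced G (.disj Φ) ↔ ∃ i, Forced G (Φ i) := by
  constructor
  · intro h
    obtain ⟨p, hp, h, i, hi⟩ := h.exists_realizes hG
    exact ⟨i, p, hp, h, hi⟩
  · rintro ⟨i, p, hp, h, hi⟩
    exact ⟨p, hp, h, .disj_intro i hi⟩

theorem forced_ex (hG : IsGeneric G) {Y : VarSet Sg.Sorts}
    {ψ : Sentence ((Sg.withConsts X).extend Y)} :
    Forced G (Sentence.ex (Sg := Sg.withConsts X) Y ψ) ↔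
      ∃ (Z : Finset (Sg.Sorts × ℕ)) (h : X ⊆ Z) (e : Y.names → ℕ)
        (he : ∀ y, (Y.sort y, e y) ∈ Z), Forced G (ψ.map (Hom.instantiate h e he)) := by
  constructor
  · intro h
    obtain ⟨p, hp, h, e, he, H⟩ := h.exists_realizes hG
    refine ⟨p.names, h, e, he, p, hp, Finset.Subset.refl _, ?_⟩
    rw [Hom.inclConsts_refl, Sentence.map_id]
    rwa [Sentence.map_comp, Hom.instantiate_comp_extend] at H
  · rintro ⟨Z, h, e, he, p, hp, hZ, H⟩
    refine ⟨p, hp, h.trans hZ, .ex_of_instantiate e (fun y => hZ (he y)) ?_⟩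
    rw [Sentence.map_comp, Hom.inclConsts_comp_instantiate] at H
    rwa [Sentence.map_comp, Hom.instantiate_comp_extend]

theorem forced_comp (hG : IsGeneric G) {s : Sg.Sorts} {t u : Term (Sg.withConsts X) s}
    {a b : Action Sg.Label} :
    Forced G (.trans t (.comp a b) u) ↔
      ∃ (Z : Finset (Sg.Sorts × ℕ)) (h : X ⊆ Z) (v : Term (Sg.withConsts Z) s), Live G Z ∧
        Forced G (Sentence.trans (Sg := Sg.withConsts Z) (t.map (Hom.inclConsts h)) a v) ∧
        Forced G (Sentence.trans (Sg := Sg.withConsts Z) v b (u.map (Hom.inclConsts h))) := by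
  constructor
  · intro h
    obtain ⟨p, hp, h, v, H, H'⟩ := h.exists_realizes hG
    refine ⟨p.names, h, v, ⟨p, hp, Finset.Subset.refl _⟩, ⟨p, hp, Finset.Subset.refl _, ?_⟩,
      ⟨p, hp, Finset.Subset.refl _, ?_⟩⟩
    all_goals
      rw [Hom.inclConsts_refl, Sentence.map_id]
      rwa [Action.map_id] at *
  · rintro ⟨Z, h, v, hZ, H, H'⟩
    rw [← forced_map h hZ]
    obtain ⟨p, hp, hZ, H⟩ := Forced.exists_entails hZ
      (φ := fun i : Bool => cond i (Sentence.trans (t.map (Hom.inclConsts h)) a v)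
        (Sentence.trans v b (u.map (Hom.inclConsts h))))
      (by rintro (_ | _) <;> assumption)
    refine ⟨p, hp, hZ, ?_⟩
    have h₁ := H true
    have h₂ := H false
    simp only [cond, Sentence.map, Action.map, Action.map_id] at h₁ h₂ ⊢
    exact .comp_intro h₁ h₂

theorem forced_union (hG : IsGeneric G) {s : Sg.Sorts} {t u : Term (Sg.withConsts X) s}
    {a b : Action Sg.Label} :
    Forced G (.trans t (.union a b) u) ↔ Forced G (.trans t a u) ∨ Forced G (.trans t b u) := by
  constructor
  · intro h
    obtain ⟨p, hp, h, H | H⟩ := h.exists_realizes hG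
    · exact .inl ⟨p, hp, h, H⟩
    · exact .inr ⟨p, hp, h, H⟩
  · rintro (⟨p, hp, h, H⟩ | ⟨p, hp, h, H⟩)
    · exact ⟨p, hp, h, .union_intro_left H⟩
    · exact ⟨p, hp, h, .union_intro_right H⟩

theorem forced_star (hG : IsGeneric G) {s : Sg.Sorts} {t u : Term (Sg.withConsts X) s}
    {a : Action Sg.Label} :
    Forced G (.trans t (.star a) u) ↔ ∃ n, Forced G (.transPow t a u n) := by
  constructor
  · intro h
    obtain ⟨p, hp, h, n, H⟩ := h.exists_realizes hG
    exact ⟨n, p, hp, h, by rwa [Sentence.map_transPow]⟩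
  · rintro ⟨n, p, hp, h, H⟩
    rw [Sentence.map_transPow] at H
    exact ⟨p, hp, h, .star_intro n H⟩

/-- Every term over constants known to a generic ideal is equal to a constant. -/
theorem exists_forced_eq_const (hG : IsGeneric G) (hX : Live G X) {s : Sg.Sorts}
    (t : Term (Sg.withConsts X) s) :
    ∃ (Z : Finset (Sg.Sorts × ℕ)) (h : X ⊆ Z) (i : ℕ) (hi : (s, i) ∈ Z), Live G Z ∧
      Forced G (Sentence.eq (Sg := Sg.withConsts Z) (t.map (Hom.inclConsts h))
        (Term.const i hi)) := by
  obtain ⟨p, hp, hXp⟩ := hX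
  have h : Forced G (Sentence.ex (Sg := Sg.withConsts X) (VarSet.single 0 s) (Sentence.eq
      (Sg := (Sg.withConsts X).extend (VarSet.single 0 s))
      (t.map (Hom.incl (Sg.withConsts X) (VarSet.single 0 s)))
      (Term.var (Sg := Sg.withConsts X) (X := VarSet.single 0 s)
        ⟨0, Finset.mem_singleton_self 0⟩))) :=
    ⟨p, hp, hXp, (Entails.exists_eq ∅ t).map _ (by simp)⟩
  obtain ⟨Z, h, e, he, H⟩ := (forced_ex hG).1 h
  refine ⟨Z, h, _, he ⟨0, Finset.mem_singleton_self 0⟩, ⟨H.choose, H.choose_spec.1,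
    H.choose_spec.2.1⟩, ?_⟩
  simp only [Sentence.map] at H
  rwa [Term.map_incl_instantiate, Term.map_var_instantiate] at H

/-! ### The generic model -/

/-- Terms of sort `s` over finitely many constants known to `G`, up to forced equality. -/
def termSetoid (G : Order.Ideal (Condition Sg)) (s : Sg.Sorts) :
    Setoid (Σ X : {X : Finset (Sg.Sorts × ℕ) // Live G X}, Term (Sg.withConsts X.1) s) where
  r a b := ∃ p ∈ G, ∃ (h : a.1.1 ⊆ p.names) (h' : b.1.1 ⊆ p.names),
    Entails (Sg.withConsts p.names) p.theory
      {.eq (a.2.map (Hom.inclConsts h)) (b.2.map (Hom.inclConsts h'))}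
  iseqv := by
    refine ⟨?_, ?_, ?_⟩
    · rintro ⟨⟨X, p, hp, hX⟩, t⟩
      exact ⟨p, hp, hX, hX, .refl _⟩
    · rintro _ _ ⟨p, hp, h, h', H⟩
      exact ⟨p, hp, h', h, .symm H⟩
    · rintro _ _ _ ⟨p, hp, h₁, h₂, H⟩ ⟨q, hq, h₂', h₃, H'⟩
      obtain ⟨r, hr, hpr, hqr⟩ := G.directed p hp q hq
      have K := Condition.entails_map hpr.1 hpr H
      have K' := Condition.entails_map hqr.1 hqr H'
      simp only [Sentence.map] at K K'
      rw [Term.map_inclConsts_comp, Term.map_inclConsts_comp] at K K'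
      exact ⟨r, hr, h₁.trans hpr.1, h₃.trans hqr.1, .trans K K'⟩

/-- The carriers of the generic model. -/
abbrev GenericCarrier (G : Order.Ideal (Condition Sg)) (s : Sg.Sorts) : Type u :=
  Quotient (termSetoid G s)

/-- The value of a term in the generic model. -/
def val (hX : Live G X) {s : Sg.Sorts} (t : Term (Sg.withConsts X) s) : GenericCarrier G s :=
  Quotient.mk _ ⟨⟨X, hX⟩, t⟩

theorem val_eq_val (hX : Live G X) {s : Sg.Sorts} {t u : Term (Sg.withConsts X) s} :
    val hX t = val hX u ↔ Forced G (.eq t u) := by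
  refine Quotient.eq.trans ⟨?_, ?_⟩
  · rintro ⟨p, hp, h, _, H⟩
    exact ⟨p, hp, h, H⟩
  · rintro ⟨p, hp, h, H⟩
    exact ⟨p, hp, h, h, H⟩

theorem val_map (hX : Live G X) (hZ : Live G Z) (h : X ⊆ Z) {s : Sg.Sorts}
    (t : Term (Sg.withConsts X) s) : val hZ (t.map (Hom.inclConsts h)) = val hX t := by
  have ⟨p, hp, hZp⟩ := hZ
  refine Quotient.sound ⟨p, hp, hZp, h.trans hZp, ?_⟩
  have := Term.map_inclConsts_comp h hZp t
  simp only [this]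
  exact .refl _

theorem val_app (hX : Live G X) {n : ℕ} {w : Fin n → Sg.Sorts} {s : Sg.Sorts}
    (σ : (Sg.withConsts X).Fn n w s) {t u : ∀ i, Term (Sg.withConsts X) (w i)}
    (h : ∀ i, val hX (t i) = val hX (u i)) :
    val hX (Term.app σ t) = val hX (Term.app σ u) := by
  simp only [val_eq_val] at h ⊢
  obtain ⟨p, hp, hXp, H⟩ := Forced.exists_entails hX h
  exact ⟨p, hp, hXp, .congr _ H⟩

/-- A finite family of elements is represented by terms over a common set of constants. -/
theorem exists_val_eq {ι : Type*} [Finite ι] {w : ι → Sg.Sorts}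
    (a : ∀ i, GenericCarrier G (w i)) :
    ∃ (Z : Finset (Sg.Sorts × ℕ)) (hZ : Live G Z) (t : ∀ i, Term (Sg.withConsts Z) (w i)),
      ∀ i, val hZ (t i) = a i := by
  have h (i : ι) : ∃ (X : Finset (Sg.Sorts × ℕ)) (hX : Live G X)
      (t : Term (Sg.withConsts X) (w i)), val hX t = a i := by
    obtain ⟨⟨⟨X, hX⟩, t⟩, ht⟩ := Quotient.exists_rep (a i)
    exact ⟨X, hX, t, ht⟩
  choose X hX t ht using h
  have hX' := hX
  choose p hp hXp using hX'
  obtain ⟨q, hq, hpq⟩ := exists_upper_bound p hp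
  refine ⟨q.names, ⟨q, hq, Finset.Subset.refl _⟩,
    fun i => (t i).map (Hom.inclConsts ((hXp i).trans (hpq i).1)), fun i => ?_⟩
  rw [← ht i]
  exact val_map (hX i) _ _ _

theorem exists_val_const (hG : IsGeneric G) {s : Sg.Sorts} (a : GenericCarrier G s) :
    ∃ (Z : Finset (Sg.Sorts × ℕ)) (hZ : Live G Z) (i : ℕ) (hi : (s, i) ∈ Z),
      val hZ (Term.const i hi) = a := by
  obtain ⟨X, hX, t, ht⟩ := exists_val_eq (ι := Unit) (w := fun _ => s) (fun _ => a)
  obtain ⟨Z, h, i, hi, hZ, H⟩ := exists_forced_eq_const hG hX (t ())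
  refine ⟨Z, hZ, i, hi, ?_⟩
  rw [← val_eq_val hZ] at H
  exact H.symm.trans ((val_map hX hZ h _).trans (ht ()))

/-- The functions of the generic model: a symbol is applied to representing terms. -/
noncomputable def genericFn (G : Order.Ideal (Condition Sg)) {n : ℕ} {w : Fin n → Sg.Sorts}
    {s : Sg.Sorts} (σ : Sg.Fn n w s) (a : ∀ i, GenericCarrier G (w i)) : GenericCarrier G s :=
  val (exists_val_eq a).choose_spec.choose
    (Term.app (Sg := Sg.withConsts _) (ConstFn.old σ)
      (exists_val_eq a).choose_spec.choose_spec.choose)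

theorem genericFn_val (hX : Live G X) {n : ℕ} {w : Fin n → Sg.Sorts} {s : Sg.Sorts}
    (σ : Sg.Fn n w s) (t : ∀ i, Term (Sg.withConsts X) (w i)) :
    genericFn G σ (fun i => val hX (t i)) =
      val hX (Term.app (Sg := Sg.withConsts X) (ConstFn.old σ) t) := by
  have h := (exists_val_eq fun i => val hX (t i)).choose_spec.choose_spec.choose_spec
  set hZ := (exists_val_eq fun i => val hX (t i)).choose_spec.choose
  obtain ⟨W, hW, hXW, hZW⟩ := hX.exists_common hZ
  rw [genericFn, ← val_map hX hW hXW, ← val_map hZ hW hZW]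
  refine val_app hW _ fun i => ?_
  exact (val_map hZ hW hZW _).trans ((h i).trans (val_map hX hW hXW _).symm)

/-- The relations of the generic model. -/
def genericRel (G : Order.Ideal (Condition Sg)) (l : Sg.Label) (s : Sg.Sorts)
    (a b : GenericCarrier G s) : Prop :=
  ∃ (X : Finset (Sg.Sorts × ℕ)) (hX : Live G X) (t u : Term (Sg.withConsts X) s),
    val hX t = a ∧ val hX u = b ∧ Forced G (.trans t (.lab l) u)

theorem genericRel_val (hX : Live G X) {l : Sg.Label} {s : Sg.Sorts}
    {t u : Term (Sg.withConsts X) s} :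
    genericRel G l s (val hX t) (val hX u) ↔ Forced G (.trans t (.lab l) u) := by
  refine ⟨?_, fun h => ⟨X, hX, t, u, rfl, rfl, h⟩⟩
  rintro ⟨Z, hZ, t', u', ht, hu, H⟩
  obtain ⟨W, hW, hXW, hZW⟩ := hX.exists_common hZ
  rw [← val_map hX hW hXW, ← val_map hZ hW hZW, val_eq_val] at ht hu
  rw [← forced_map hZW hW] at H
  rw [← forced_map hXW hW]
  obtain ⟨p, hp, hWp, K⟩ := Forced.exists_entails hW (φ := ![_, _, _]) (by
    rintro i
    fin_cases i
    exacts [ht, hu, H])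
  exact ⟨p, hp, hWp, .pred (K 0) (K 1) (K 2)⟩

/-- The model given by a generic ideal. -/
noncomputable def genericModel (G : Order.Ideal (Condition Sg)) : Model Sg where
  carrier := GenericCarrier G
  fn := genericFn G
  rel := genericRel G
  mono := by
    intro n w s σ hσ l a k b hab
    obtain ⟨X, hX, t, ht⟩ := exists_val_eq a
    obtain ⟨Z, hZ, u, hu⟩ := exists_val_eq (ι := Unit) (w := fun _ => w k) (fun _ => b)
    obtain ⟨W, hW, hXW, hZW⟩ := hX.exists_common hZ
    obtain rfl : (fun i => val hW ((t i).map (Hom.inclConsts hXW))) = a :=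
      funext fun i => (val_map hX hW hXW _).trans (ht i)
    obtain rfl : val hW ((u ()).map (Hom.inclConsts hZW)) = b :=
      (val_map hZ hW hZW _).trans (hu ())
    have key : Function.update (fun i => val hW ((t i).map (Hom.inclConsts hXW))) k
        (val hW ((u ()).map (Hom.inclConsts hZW))) = fun i => val hW (Function.update
          (fun i => (t i).map (Hom.inclConsts hXW)) k ((u ()).map (Hom.inclConsts hZW)) i) := by
      funext i
      exact (Function.apply_update (fun _ => val hW) _ _ _ _).symm
    rw [key, genericFn_val, genericFn_val, genericRel_val]
    rw [genericRel_val] at hab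
    obtain ⟨p, hp, hWp, K⟩ := hab
    refine ⟨p, hp, hWp, ?_⟩
    have H := Entails.mono (Sg := Sg.withConsts p.names) (ConstFn.old σ) ⟨σ, hσ, rfl⟩
      (fun i => ((t i).map (Hom.inclConsts hXW)).map (Hom.inclConsts hWp)) k _ K
    have hupd : (fun i => (Function.update (fun i => (t i).map (Hom.inclConsts hXW)) k
          ((u ()).map (Hom.inclConsts hZW)) i).map (Hom.inclConsts hWp)) =
        Function.update (fun i => ((t i).map (Hom.inclConsts hXW)).map (Hom.inclConsts hWp)) k
          (((u ()).map (Hom.inclConsts hZW)).map (Hom.inclConsts hWp)) :=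
      funext fun i => Function.apply_update
        (fun _ (t : Term (Sg.withConsts W) _) => t.map (Hom.inclConsts hWp)) _ _ _ _
    rw [← hupd] at H
    exact H

/-- The expansion of the generic model by the values of the constants in `X`. -/
noncomputable abbrev stageModel (hX : Live G X) : Model (Sg.withConsts X) where
  carrier := fun s => GenericCarrier (Sg := Sg) G s
  fn := fun τ => match τ with
    | ConstFn.old σ => (genericModel G).fn σ
    | ConstFn.const i h _ => fun _ => val hX (Term.const i h)
  rel := genericRel G
  mono := by
    rintro n w s _ ⟨σ, hσ, rfl⟩
    exact (genericModel G).mono σ hσ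

theorem eval_stageModel (hX : Live G X) {s : (Sg.withConsts X).Sorts}
    (t : Term (Sg.withConsts X) s) : t.eval (stageModel hX) = val hX t := by
  induction t with
  | app σ ts ih =>
    simp only [Term.eval, ih]
    rcases σ with σ | ⟨i, h, w⟩
    · exact genericFn_val hX σ ts
    · obtain rfl : w = Fin.elim0 := Subsingleton.elim _ _
      obtain rfl : ts = fun k => k.elim0 := funext fun k => k.elim0
      rfl

theorem reduct_stageModel (hX : Live G X) (hZ : Live G Z) (h : X ⊆ Z) {Y : VarSet Sg.Sorts}
    (e : Y.names → ℕ) (he : ∀ y, (Y.sort y, e y) ∈ Z) :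
    (stageModel hZ).reduct (Hom.instantiate h e he) =
      (stageModel hX).expand (X := Y) fun y => val hZ (Term.const (e y) (he y)) := by
  refine Model.ext_fn fun n w s σ a => ?_
  rcases σ with (σ | ⟨i, hi, w⟩) | ⟨y, w⟩
  · rfl
  · refine Eq.trans ?_ (val_map hX hZ h (Term.const i hi))
    rw [Term.map_const]
  · rfl

theorem reflTransGen_act_iff {A : Model Sg} {a : Action Sg.Label} {s : Sg.Sorts}
    {x y : A.carrier s} :
    Relation.ReflTransGen (A.act a s) x y ↔ x = y ∨ ∃ n, A.act (a.powSucc n) s x y := by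
  constructor
  · intro h
    induction h using Relation.ReflTransGen.head_induction_on with
    | refl => exact .inl rfl
    | head hxz _ ih =>
      rcases ih with rfl | ⟨n, hn⟩
      · exact .inr ⟨0, hxz⟩
      · exact .inr ⟨n + 1, _, hxz, hn⟩
  · rintro (rfl | ⟨n, hn⟩)
    · exact .refl
    · induction n generalizing x with
      | zero => exact .single hn
      | succ n ih =>
        obtain ⟨z, hxz, hz⟩ := hn
        exact (ih hz).head hxz

/-- The composition step of `forced_trans_iff_act`, which is used for `a ; b` and also for the
powers of `a`, as these are not subactions of `a*`. -/
theorem forced_comp_iff_act (hG : IsGeneric G) {a b : Action Sg.Label}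
    (iha : ∀ {X : Finset (Sg.Sorts × ℕ)} (hX : Live G X) {s : Sg.Sorts}
      {t u : Term (Sg.withConsts X) s},
      Forced G (.trans t a u) ↔ (genericModel G).act a s (val hX t) (val hX u))
    (ihb : ∀ {X : Finset (Sg.Sorts × ℕ)} (hX : Live G X) {s : Sg.Sorts}
      {t u : Term (Sg.withConsts X) s},
      Forced G (.trans t b u) ↔ (genericModel G).act b s (val hX t) (val hX u))
    (hX : Live G X) {s : Sg.Sorts} {t u : Term (Sg.withConsts X) s} :
    Forced G (.trans t (.comp a b) u) ↔
      (genericModel G).act (.comp a b) s (val hX t) (val hX u) := by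
  rw [forced_comp hG]
  constructor
  · rintro ⟨Z, h, v, hZ, H, H'⟩
    rw [iha hZ, val_map hX hZ h] at H
    rw [ihb hZ, val_map hX hZ h] at H'
    exact ⟨_, H, H'⟩
  · rintro ⟨x, H, H'⟩
    obtain ⟨Z, hZ, v, hv⟩ := exists_val_eq (ι := Unit) (w := fun _ => s) (fun _ => x)
    obtain ⟨W, hW, hXW, hZW⟩ := hX.exists_common hZ
    obtain rfl : val hW ((v ()).map (Hom.inclConsts hZW)) = x :=
      (val_map hZ hW hZW _).trans (hv ())
    rw [← val_map hX hW hXW, ← iha hW] at H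
    rw [← val_map hX hW hXW, ← ihb hW] at H'
    exact ⟨W, hXW, _, hW, H, H'⟩

/-- Transitions are forced if and only if they hold in the generic model. -/
theorem forced_trans_iff_act (hG : IsGeneric G) (a : Action Sg.Label) (hX : Live G X)
    {s : Sg.Sorts} {t u : Term (Sg.withConsts X) s} :
    Forced G (.trans t a u) ↔ (genericModel G).act a s (val hX t) (val hX u) := by
  induction a generalizing X s with
  | lab l => exact (genericRel_val hX).symm
  | comp a b iha ihb => exact forced_comp_iff_act hG iha ihb hX
  | union a b iha ihb => rw [forced_union hG, iha hX, ihb hX]; rfl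
  | star a iha =>
    have hpow (n : ℕ) : ∀ {X : Finset (Sg.Sorts × ℕ)} (hX : Live G X) {s : Sg.Sorts}
        {t u : Term (Sg.withConsts X) s}, Forced G (.trans t (a.powSucc n) u) ↔
          (genericModel G).act (a.powSucc n) s (val hX t) (val hX u) := by
      induction n with
      | zero => exact iha
      | succ n ihn => exact fun hX => forced_comp_iff_act hG iha ihn hX
    refine (forced_star hG).trans (Iff.trans ?_ reflTransGen_act_iff.symm)
    rw [← Nat.or_exists_add_one]
    exact or_congr (val_eq_val hX).symm (exists_congr fun n => hpow n hX)

theorem act_stageModel (hX : Live G X) (a : Action Sg.Label) (s : Sg.Sorts) :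
    (stageModel hX).act a s = (genericModel G).act a s :=
  (Action.map_id a ▸ Model.act_map (stageModel hX) (Hom.toConsts Sg X) a s :)

/-- The truth lemma: truth in the generic model is forcing by the generic ideal. Sentences are
taken along morphisms so that structural induction passes under quantifiers, where the signature
of the sentence is extended by variables and the variables are then named by constants. -/
theorem sat_iff_forced (hG : IsGeneric G) {Sg' : Signature.{u}} (φ : Sentence Sg')
    (hX : Live G X) (χ : Hom Sg' (Sg.withConsts X)) :
    Sat (φ.map χ) (stageModel hX) ↔ Forced G (φ.map χ) := by
  induction φ generalizing X with
  | eq t u =>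
    simp only [Sentence.map, Sat, eval_stageModel]
    exact val_eq_val hX
  | trans t a u =>
    simp only [Sentence.map, Sat, eval_stageModel]
    rw [forced_trans_iff_act hG _ hX, act_stageModel]
  | neg φ ih => simp only [Sentence.map, Sat, forced_neg hG hX, ih]
  | disj Φ ih => simp only [Sentence.map, Sat, forced_disj hG, ih]
  | ex Y φ ih =>
    simp only [Sentence.map, Sat]
    refine Iff.trans ?_ (forced_ex (Sg := Sg) (Y := Y.map χ.sort) hG).symm
    have key {Z : Finset (Sg.Sorts × ℕ)} (hZ : Live G Z) (h : X ⊆ Z) (e : Y.names → ℕ)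
        (he : ∀ y, (χ.sort (Y.sort y), e y) ∈ Z) :
        Sat (φ.map (χ.extend Y)) ((stageModel hX).expand (X := Y.map χ.sort)
            fun y => val hZ (Term.const (e y) (he y))) ↔
          Forced G ((φ.map (χ.extend Y)).map
            (Hom.instantiate (Y := Y.map χ.sort) h e he)) := by
      rw [← reduct_stageModel hX hZ h (Y := Y.map χ.sort) e he, ← sat_map, Sentence.map_comp]
      exact ih hZ _
    constructor
    · rintro ⟨g, H⟩
      choose Z hZ i hi hg using fun y => exists_val_const hG (g y)
      have hZ' := hZ
      choose p hp hpZ using hZ'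
      obtain ⟨q, hq, hpq⟩ := exists_upper_bound p hp
      obtain ⟨W, hW, hXW, hqW⟩ := hX.exists_common ⟨q, hq, Finset.Subset.refl _⟩
      have hZW (y) : Z y ⊆ W := ((hpZ y).trans (hpq y).1).trans hqW
      have hgW : g = fun y => val hW (Term.const (i y) (hZW y (hi y))) := by
        funext y
        rw [← Term.map_const (hZW y) (i y) (hi y), val_map (hZ y), hg]
      rw [hgW, key hW hXW] at H
      exact ⟨W, hXW, i, _, H⟩
    · rintro ⟨Z, h, e, he, H⟩
      have hZ : Live G Z := ⟨H.choose, H.choose_spec.1, H.choose_spec.2.1⟩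
      exact ⟨_, (key hZ h e he).2 H⟩

theorem genericModel_isCountable (hSg : Sg.IsCountable) (G : Order.Ideal (Condition Sg)) :
    (genericModel G).IsCountable := by
  have := hSg.1
  have (X : Finset (Sg.Sorts × ℕ)) (s : Sg.Sorts) : Countable (Term (Sg.withConsts X) s) := by
    have := countable_sigma_term (hSg.withConsts X)
    exact (sigma_mk_injective (i := s) (β := fun s => Term (Sg.withConsts X) s)).countable
  have (s : Sg.Sorts) : Countable (GenericCarrier G s) := Quotient.countable
  exact (inferInstance : Countable (Σ s : Sg.Sorts, GenericCarrier G s))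

end TransitionAlgebra

theorem mainTheorem2 (Sg : TransitionAlgebra.Signature.{u}) (hSg : Sg.IsCountable)
    (Γ : Set (TransitionAlgebra.Sentence Sg)) (hΓ : TransitionAlgebra.Consistent Γ) :
    ∃ A : TransitionAlgebra.Model Sg, A.IsCountable ∧ A.Satisfies Γ := by
  open TransitionAlgebra in
  -- no constant has been added yet, so forgetting the constants is a morphism
  let κ : Hom (Sg.withConsts ∅) Sg :=
    { sort := fun s => s
      fn := fun τ => match τ with
        | ConstFn.old σ => σ
        | ConstFn.const _ h _ => absurd h (Finset.notMem_empty _)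
      mono := by
        rintro n w s _ ⟨σ, hσ, rfl⟩
        exact hσ
      lab := fun l => l }
  have hκ : κ.comp (Hom.toConsts Sg ∅) = Hom.id Sg := rfl
  obtain ⟨G, hp, hG⟩ := exists_isGeneric hSg ⟨∅, _, hΓ.image hκ⟩
  have hX : Live G ∅ := ⟨_, hp, Finset.Subset.refl _⟩
  refine ⟨genericModel G, genericModel_isCountable hSg G, fun φ hφ => ?_⟩
  have h : Sat (φ.map (Hom.toConsts Sg ∅)) (stageModel hX) := by
    refine (sat_iff_forced hG φ hX _).2 ⟨_, hp, Finset.Subset.refl _, .of_mem ?_⟩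
    rw [Hom.inclConsts_refl, Sentence.map_id]
    exact ⟨φ, hφ, rfl⟩
  exact (sat_map _ _ _).1 h
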